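/- A \emph{biresidue matrix} is a skew-symmetric complex matrix $B=(b_{ij})_{i,j=0}^{n-1}$. For $i\neq j$, the edge $i - j$ of the complete graph on the vertices $0,\dots,n-1$ is called \emph{smoothable} for $B$ if $b_{ij}\neq 0$ and, for every $k\neq i,j$, the number $\frac{b_{jk}+b_{ki}}{b_{ij}}$ is a non-negative integer. We say that $B$ has a \emph{full smoothable cycle} if the graph formed by the smoothable edges contains a cycle passing through all $n$ vertices (each exactly once; a cycle has at least three vertices). Two $n\times n$ biresidue matrices $B,B'$ are \emph{projectively equivalent} if $B'=\lambda P^{-1}BP$ for some permutation matrix $P$ and some $\lambda\in\mathbb{C}\setminus\{0\}$. For $n\ge 3$ and $1\le k<n/2$, let $\mathcal{C}_{n,k}$ be the $n\times n$ matrix whose zeroth row is $$(0,\underbrace{1,\dots,1}_{k},\underbrace{0,\dots,0}_{n-1-2k},\underbrace{-1,\dots,-1}_{k})$$ and whose $i$-th row, $0\le i\le n-1$, is obtained from the zeroth one by a cyclic shift by $i$ positions to the right. \textbf{Corollary.} Let $B$ be an $n\times n$ biresidue matrix in which each row has zero sum, and suppose that $B$ has rank $n-1$. Then $B$ has a full smoothable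 cycle if and only if it is projectively equivalent to $\mathcal{C}_{n,k}$ for some integer $k$ with $1\le k<n/2$ and $\gcd(n,k)=\gcd(n,k+1)=1$. -/

import Mathlib

noncomputable section

/-- A biresidue matrix is a skew-symmetric complex matrix. -/
def IsBiresidueMatrix {n : ℕ} (B : Matrix (Fin n) (Fin n) ℂ) : Prop :=
  B.transpose = -B

/-- The edge `i — j` of the complete graph on the index set is smoothable for `B` if `B i j ≠ 0` and
`θ i j k = (B j k + B k i) / B i j` is a non-negative integer for every `k ≠ i, j`. -/
def IsSmoothable {n : ℕ} (B : Matrix (Fin n) (Fin n) ℂ) (i j : Fin n) : Prop :=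
  B i j ≠ 0 ∧ ∀ k : Fin n, k ≠ i → k ≠ j → ∃ m : ℕ, (B j k + B k i) / B i j = (m : ℂ)

/-- The graph formed by the smoothable edges. The condition is symmetric in `i`, `j` for a
skew-symmetric matrix, see `smoothableGraph_adj`. -/
def smoothableGraph {n : ℕ} (B : Matrix (Fin n) (Fin n) ℂ) : SimpleGraph (Fin n) :=
  SimpleGraph.fromRel (IsSmoothable B)

theorem IsBiresidueMatrix.apply_swap {n : ℕ} {B : Matrix (Fin n) (Fin n) ℂ}
    (hB : IsBiresidueMatrix B) (i j : Fin n) : B j i = -B i j := by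
  have h := congrFun (congrFun hB i) j
  simpa using h

theorem IsSmoothable.symm {n : ℕ} {B : Matrix (Fin n) (Fin n) ℂ} (hB : IsBiresidueMatrix B)
    {i j : Fin n} (h : IsSmoothable B i j) : IsSmoothable B j i := by
  refine ⟨by rw [hB.apply_swap i j]; exact neg_ne_zero.mpr h.1, fun k hj hi => ?_⟩
  obtain ⟨m, hm⟩ := h.2 k hi hj
  refine ⟨m, ?_⟩
  rw [← hm, hB.apply_swap i j, hB.apply_swap k i, hB.apply_swap j k, ← neg_add, neg_div_neg_eq,
    add_comm]

theorem smoothableGraph_adj {n : ℕ} {B : Matrix (Fin n) (Fin n) ℂ} (hB : IsBiresidueMatrix B)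
    (i j : Fin n) : (smoothableGraph B).Adj i j ↔ i ≠ j ∧ IsSmoothable B i j := by
  rw [smoothableGraph, SimpleGraph.fromRel_adj]
  exact ⟨fun h => ⟨h.1, h.2.elim id (IsSmoothable.symm hB)⟩, fun h => ⟨h.1, Or.inl h.2⟩⟩

/-- `B` has a full smoothable cycle: the smoothable edges contain a cycle through all the
vertices. (A cycle has at least three vertices.) -/
def HasFullSmoothableCycle {n : ℕ} (B : Matrix (Fin n) (Fin n) ℂ) : Prop :=
  ∃ (v : Fin n) (p : (smoothableGraph B).Walk v v), p.IsHamiltonianCycle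

/-- `B` and `B'` are projectively equivalent: `B' = c P⁻¹ B P` for a permutation matrix `P` and a
non-zero scalar `c`. -/
def ProjectivelyEquivalent {n : ℕ} (B B' : Matrix (Fin n) (Fin n) ℂ) : Prop :=
  ∃ (σ : Equiv.Perm (Fin n)) (c : ℂ), c ≠ 0 ∧
    B' = c • ((σ.permMatrix ℂ)⁻¹ * B * σ.permMatrix ℂ)

/-- The row vector `(0, 1, …, 1, 0, …, 0, -1, …, -1)` with `k` ones and `k` minus ones. -/
def cyclicRow (n k : ℕ) : Fin n → ℂ := fun j =>
  if 1 ≤ j.val ∧ j.val ≤ k then 1 else if n - k ≤ j.val ∧ 1 ≤ j.val then -1 else 0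

/-- The matrix `𝒞 n k`, whose `i`-th row is `cyclicRow n k` shifted cyclically by `i` positions to
the right (the subtraction `j - i` is modulo `n`). It is used for `1 ≤ k < n / 2`. -/
def cyclicMatrix (n k : ℕ) : Matrix (Fin n) (Fin n) ℂ :=
  Matrix.of fun i j => cyclicRow n k (j - i)

end

open Finset

/-! The circulant matrices have a full smoothable cycle by inspection: along the edges `i — i + 1`
all the quotients are 0, 1 or 2. For the converse, number the vertices along the cycle by integers
modulo `n`. Smoothability says that row `i + 1` is row `i` plus `c i` times an integer row, equal to
-1 at both ends of the edge and non-negative elsewhere; zero row sums make the non-negative part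
total 2. By skew-symmetry the same integers govern the drops along the rows, so rows decrease around
the cycle, and they tie together the ratios of consecutive edges (`exchange`), so that one scaling
makes everything real (`exists_cyclicBiresidue`).

The rank enters twice: `n` is odd (`odd_of_rank`), and only constant vectors lie in the kernel
(`kernelConstant_of_rank`). Scale the shortest edge to 1. If some edge is longer, a unit edge is
followed by a longer one; the total 2, the exchange identity and parity then force the edges 1, 2,
2, 1 and nearly determine five rows (`run_of_edge_lt`). With `n = 2 * h + 1`, such a run forces
another one `h - 2` positions further, and two such moves shift by -5 modulo `n`. If 5 does not
divide `n`, runs start everywhere, which is absurd; if it does, the indicator of two residue classes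
modulo 5 is a non-constant kernel vector (`edge_eq_one`).

With unit edges, each row is a block of ones, then zeros, then an equally long block of minus ones.
Skew-symmetry compares the block widths of different rows, and indicators of the multiples of a
common divisor, as potential kernel vectors, give the coprimality conditions and the constancy of
the width (`circulant_of_edge_eq_one`). -/

/-- The sum of a periodic function over a period does not depend on the starting point. -/
theorem sum_range_periodic {R : Type*} [AddCommGroup R] {m : ℕ} {f : ℤ → R}
    (hf : ∀ j, f (j + m) = f j) (x y : ℤ) :
    ∑ d ∈ range m, f (x + d) = ∑ d ∈ range m, f (y + d) := by
  have key : ∀ z : ℤ, ∑ d ∈ range m, f (z + 1 + d) = ∑ d ∈ range m, f (z + d) := by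
    intro z
    have h1 := Finset.sum_range_succ (fun d : ℕ => f (z + d)) m
    have h2 := Finset.sum_range_succ' (fun d : ℕ => f (z + d)) m
    rw [h1] at h2
    simp only [hf, Nat.cast_zero, add_zero, Nat.cast_add, Nat.cast_one] at h2
    have h3 := add_right_cancel h2
    rw [h3]
    refine Finset.sum_congr rfl fun d _ => ?_
    congr 1; ring
  have all : ∀ z : ℤ, ∑ d ∈ range m, f (z + d) = ∑ d ∈ range m, f (0 + d) := by
    intro z
    induction z using Int.induction_on with
    | zero => rfl
    | succ k ih => rw [key, ih]
    | pred k ih => rw [← key, sub_add_cancel, ih]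
  rw [all x, all y]

/-- The biresidues `b i j` along a cycle of `n` smoothable edges, indexed by the integers modulo
`n`; `c i` is the biresidue of the `i`-th edge, and `c i * M i j` the increment of the column `j`
from the `i`-th row to the next. -/
structure CyclicBiresidue (n : ℕ) (b : ℤ → ℤ → ℝ) (c : ℤ → ℝ) (M : ℤ → ℤ → ℤ) : Prop where
  three_le : 3 ≤ n
  skew : ∀ i j, b i j = -b j i
  periodic : ∀ i j, b (i + n) j = b i j
  pos : ∀ i, 0 < c i
  step : ∀ i j, b (i + 1) j = b i j + c i * M i j
  incr_self : ∀ i, M i i = -1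
  incr_succ : ∀ i, M i (i + 1) = -1
  incr_nonneg : ∀ i j : ℤ, i + 1 < j → j < i + n → 0 ≤ M i j
  row_sum : ∀ i, ∑ d ∈ range n, b i (i + d) = 0

/-- The kernel of the periodic matrix `b` consists of the constant vectors. -/
def KernelConstant (n : ℕ) (b : ℤ → ℤ → ℝ) : Prop :=
  ∀ v : ℤ → ℝ, (∀ j, v (j + n) = v j) → (∀ i, ∑ d ∈ range n, b i (i + d) * v (i + d) = 0) →
    ∀ i j, v i = v j

/-! ### Monotonicity of rows and the total increment of a row -/

namespace CyclicBiresidue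

variable {n : ℕ} {b : ℤ → ℤ → ℝ} {c : ℤ → ℝ} {M : ℤ → ℤ → ℤ}

theorem periodic_right (D : CyclicBiresidue n b c M) (i j : ℤ) : b i (j + n) = b i j := by
  rw [D.skew, D.periodic, ← D.skew]

theorem diag (D : CyclicBiresidue n b c M) (i : ℤ) : b i i = 0 := by
  have := D.skew i i; linarith

theorem edge (D : CyclicBiresidue n b c M) (i : ℤ) : b i (i + 1) = c i := by
  have h := D.step i (i + 1)
  rw [D.incr_succ, D.diag] at h
  push_cast at h; linarith

theorem edge_back (D : CyclicBiresidue n b c M) (i : ℤ) : b (i + 1) i = -c i := by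
  rw [D.skew, D.edge]

theorem edge_periodic (D : CyclicBiresidue n b c M) (i : ℤ) : c (i + n) = c i := by
  rw [← D.edge, ← D.edge, D.periodic, add_right_comm, D.periodic_right]

theorem incr_periodic_right (D : CyclicBiresidue n b c M) (i j : ℤ) : M i (j + n) = M i j := by
  have h1 := D.step i j
  have h2 := D.step i (j + n)
  rw [D.periodic_right, D.periodic_right] at h2
  have h3 : c i * (M i (j + n) : ℝ) = c i * M i j := by linarith
  exact_mod_cast mul_left_cancel₀ (D.pos i).ne' h3

theorem drop (D : CyclicBiresidue n b c M) (i j : ℤ) : b i (j + 1) = b i j - c j * M j i := by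
  rw [D.skew i (j + 1), D.skew i j, D.step]; ring

/-- The second differences of `b` are skew-symmetric. -/
theorem exchange (D : CyclicBiresidue n b c M) (i j : ℤ) :
    c i * (M i (j + 1) - M i j) = c j * (M j i - M j (i + 1)) := by
  have h1 := D.step i j
  have h2 := D.step i (j + 1)
  have h3 := D.drop i j
  have h4 := D.drop (i + 1) j
  linear_combination h1 - h2 - h3 + h4

/-- The case `j = i + 1` of the exchange identity, where two of the four increments are -1. It makes
the ratio of consecutive edges a quotient of small positive integers. -/
theorem exchange_adjacent (D : CyclicBiresidue n b c M) (i : ℤ) :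
    c (i + 1) * (1 + M (i + 1) i) = c i * (1 + M i (i + 2)) := by
  have h := D.exchange i (i + 1)
  rw [D.incr_succ, D.incr_self] at h
  rw [show i + 2 = i + 1 + 1 by ring]
  push_cast at h
  linarith

/-- By skew-symmetry, moving one column to the right subtracts an edge times one of its increments;
the bounds on `j` keep that increment away from the two entries -1. -/
theorem antitone_succ (D : CyclicBiresidue n b c M) {i j : ℤ} (h1 : i < j) (h2 : j + 1 < i + n) :
    b i (j + 1) ≤ b i j := by
  rw [D.drop]
  have := D.incr_nonneg j (i + n) h2 (by omega)
  rw [D.incr_periodic_right] at this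
  have h3 : (0 : ℝ) ≤ M j i := by exact_mod_cast this
  have := mul_nonneg (D.pos j).le h3
  linarith

theorem antitone (D : CyclicBiresidue n b c M) {i j k : ℤ} (h1 : i < j) (hjk : j ≤ k)
    (h2 : k < i + n) : b i k ≤ b i j := by
  induction k, hjk using Int.leInduction with
  | base => exact le_rfl
  | succ k hk ih => exact (D.antitone_succ (by omega) h2).trans (ih (by omega))

theorem le_edge (D : CyclicBiresidue n b c M) {i j : ℤ} (h1 : i < j) (h2 : j < i + n) :
    b i j ≤ c i := by
  rw [← D.edge]; exact D.antitone (by omega) (by omega) h2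

theorem neg_edge_le (D : CyclicBiresidue n b c M) {i j : ℤ} (h1 : i + 1 < j)
    (h2 : j < i + 1 + n) : -c i ≤ b (i + 1) j := by
  rw [← D.edge_back, ← D.periodic_right (i + 1) i]
  exact D.antitone (by omega) (by omega) (by omega)

theorem incr_sum (D : CyclicBiresidue n b c M) (i : ℤ) :
    ∑ d ∈ range n, M i (i + d) = 0 := by
  have h1 := D.row_sum i
  have h2 := D.row_sum (i + 1)
  rw [sum_range_periodic (f := b (i + 1)) (D.periodic_right _) _ i] at h2
  simp only [D.step, sum_add_distrib, h1, ← mul_sum] at h2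
  have h3 := (mul_eq_zero.1 ((zero_add _).symm.trans h2)).resolve_left (D.pos i).ne'
  exact_mod_cast h3

/-- The two entries -1 at the ends of the edge must be compensated. Hence a row of increments has
either a single 2 or two 1s, and all later case analyses spend this total. -/
theorem incr_sum_Ico (D : CyclicBiresidue n b c M) (i : ℤ) :
    ∑ d ∈ Ico 2 n, M i (i + d) = 2 := by
  have h := D.incr_sum i
  have h3 := D.three_le
  rw [← Finset.sum_range_add_sum_Ico _ (show 2 ≤ n by omega)] at h
  simp only [sum_range_succ, range_zero, sum_empty, Nat.cast_zero, add_zero, Nat.cast_one,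
    D.incr_self, D.incr_succ] at h
  omega

theorem incr_sum_le (D : CyclicBiresidue n b c M) (i : ℤ) (s : Finset ℤ)
    (hs : ∀ x ∈ s, i + 1 < x ∧ x < i + n) : ∑ x ∈ s, M i x ≤ 2 := by
  have h := D.incr_sum_Ico i
  have h2 : ∑ d ∈ Ico 2 n, M i (i + d) = ∑ x ∈ Ioo (i + 1) (i + n), M i x := by
    refine Finset.sum_bij (fun d _ => i + (d : ℤ)) ?_ ?_ ?_ ?_
    · intro d hd; simp only [mem_Ico, mem_Ioo] at *; omega
    · intro d _ e _ hde; simpa using hde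
    · intro x hx
      simp only [mem_Ioo] at hx
      refine ⟨(x - i).toNat, ?_, ?_⟩
      · simp only [mem_Ico]; omega
      · omega
    · intro d _; rfl
  rw [← h, h2]
  refine Finset.sum_le_sum_of_subset_of_nonneg ?_ ?_
  · intro x hx; exact mem_Ioo.2 (hs x hx)
  · intro x hx _; rw [mem_Ioo] at hx; exact D.incr_nonneg i x hx.1 hx.2

theorem incr_le_two (D : CyclicBiresidue n b c M) {i x : ℤ} (hx : i + 1 < x ∧ x < i + n) :
    M i x ≤ 2 := by
  simpa using D.incr_sum_le i {x} (by simpa using hx)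

theorem incr_add_le (D : CyclicBiresidue n b c M) {i x y : ℤ} (hx : i + 1 < x ∧ x < i + n)
    (hy : i + 1 < y ∧ y < i + n) (hxy : x ≠ y) : M i x + M i y ≤ 2 := by
  have := D.incr_sum_le i {x, y} (by simp [hx, hy])
  rwa [sum_pair hxy] at this

theorem incr_add_add_le (D : CyclicBiresidue n b c M) {i x y z : ℤ}
    (hx : i + 1 < x ∧ x < i + n) (hy : i + 1 < y ∧ y < i + n) (hz : i + 1 < z ∧ z < i + n)
    (hxy : x ≠ y) (hxz : x ≠ z) (hyz : y ≠ z) : M i x + M i y + M i z ≤ 2 := by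
  have := D.incr_sum_le i {x, y, z} (by simp [hx, hy, hz])
  rwa [sum_insert (by simp [hxy, hxz]), sum_pair hyz, ← add_assoc] at this

/-- Apart from the position `x`, a row of increments has a positive entry as soon as its entry
at `x` is at most one. -/
theorem exists_incr_pos (D : CyclicBiresidue n b c M) (i x : ℤ) (hx : M i x ≤ 1) :
    ∃ y, i + 1 < y ∧ y < i + n ∧ y ≠ x ∧ 1 ≤ M i y := by
  by_contra! hcon
  have h := D.incr_sum_Ico i
  have h2 : ∑ d ∈ Ico 2 n, M i (i + d) ≤ ∑ d ∈ Ico 2 n, if d = (x - i).toNat then 1 else 0 := by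
    refine Finset.sum_le_sum fun d hd => ?_
    rw [mem_Ico] at hd
    by_cases hdx : i + (d : ℤ) = x
    · rw [if_pos (by omega), hdx]; exact hx
    · have := hcon (i + d) (by omega) (by omega) hdx
      split_ifs <;> omega
  rw [Finset.sum_ite_eq'] at h2
  split_ifs at h2 <;> omega

/-- Monotonicity bounds column `j` below by `-c i` before the edge `i + 1` and above by `c (i + 2)`
after it, which limits the jump in between. -/
theorem edge_mul_incr_le (D : CyclicBiresidue n b c M) {i j : ℤ} (h1 : i + 2 < j)
    (h2 : j < i + 1 + n) : c (i + 1) * M (i + 1) j ≤ c i + c (i + 2) := by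
  have h3 := D.step (i + 1) j
  have h4 := D.neg_edge_le (i := i) (j := j) (by omega) (by omega)
  have h5 := D.le_edge (i := i + 1 + 1) (j := j) (by omega) (by omega)
  rw [show i + 2 = i + 1 + 1 by ring]
  linarith

theorem edge_le_add (D : CyclicBiresidue n b c M) (i : ℤ) : c (i + 1) ≤ c i + c (i + 2) := by
  obtain ⟨y, h1, h2, -, h3⟩ := D.exists_incr_pos (i + 1) (i + 1) (by rw [D.incr_self]; omega)
  have h4 := D.edge_mul_incr_le (i := i) (j := y) (by omega) (by omega)
  have h5 : (1 : ℝ) ≤ M (i + 1) y := by exact_mod_cast h3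
  nlinarith [D.pos (i + 1)]

end CyclicBiresidue

/-! ### Edges next to a minimal edge -/

theorem sum_signs {s : Finset ℕ} {f : ℕ → ℝ} (hf : ∀ d ∈ s, f d = 1 ∨ f d = -1) :
    ∃ z : ℤ, ∑ d ∈ s, f d = s.card + 2 * z := by
  induction s using Finset.induction_on with
  | empty => exact ⟨0, by simp⟩
  | insert a s ha ih =>
    obtain ⟨z, hz⟩ := ih fun d hd => hf d (mem_insert_of_mem hd)
    rw [sum_insert ha, card_insert_of_notMem ha, hz]
    rcases hf a (mem_insert_self a s) with h | h
    · exact ⟨z, by rw [h]; push_cast; ring⟩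
    · exact ⟨z - 1, by rw [h]; push_cast; ring⟩

namespace CyclicBiresidue

variable {n : ℕ} {b : ℤ → ℤ → ℝ} {c : ℤ → ℝ} {M : ℤ → ℤ → ℤ}

/-- A parity obstruction. A jump by 2 has only the room from -1 to 1, and monotonicity then makes
every entry of row `i + 1` off the diagonal and the edge a sign. The row sum is 2 plus `n - 2`
signs, so it cannot vanish for odd `n`. -/
theorem not_one_two_one (D : CyclicBiresidue n b c M) (hodd : Odd n) {i : ℤ} (h0 : c i = 1)
    (h1 : c (i + 1) = 2) (h2 : c (i + 2) = 1) : False := by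
  have hn := D.three_le
  have e2 : i + 1 + 1 = i + 2 := by ring
  have hM : ∀ j, i + 2 < j → j < i + 1 + n → M (i + 1) j = 0 ∨ M (i + 1) j = 1 := by
    intro j hj hj'
    have h := D.edge_mul_incr_le hj hj'
    have h' := D.incr_nonneg (i + 1) j (by omega) hj'
    rw [h0, h1, h2] at h
    have : (M (i + 1) j : ℝ) ≤ 1 := by linarith
    have : M (i + 1) j ≤ 1 := by exact_mod_cast this
    omega
  have hstep := D.step (i + 1)
  rw [e2, h1] at hstep
  obtain ⟨y, hy1, hy2, -, hy⟩ := D.exists_incr_pos (i + 1) (i + 1) (by rw [D.incr_self]; omega)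
  have hy3 : M (i + 1) y = 1 := by have := hM y (by omega) hy2; omega
  have hlo : ∀ j, i + 1 < j → j < i + 1 + n → -1 ≤ b (i + 1) j := by
    intro j hj hj'
    have := D.neg_edge_le hj hj'
    rwa [h0] at this
  have hhi : ∀ j, i + 2 < j → j < i + 2 + n → b (i + 2) j ≤ 1 := by
    intro j hj hj'
    have := D.le_edge hj hj'
    rwa [h2] at this
  have hby : b (i + 1) y = -1 ∧ b (i + 2) y = 1 := by
    have h3 := hstep y
    rw [hy3] at h3
    have h4 := hlo y (by omega) hy2
    have h5 := hhi y (by omega) (by omega)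
    push_cast at h3
    constructor <;> linarith
  have hsign : ∀ d ∈ Ico 2 n, b (i + 1) (i + 1 + d) = 1 ∨ b (i + 1) (i + 1 + d) = -1 := by
    intro d hd
    rw [mem_Ico] at hd
    generalize hj : i + 1 + (d : ℤ) = j
    rcases lt_or_ge j y with hjy | hjy
    · have h3 := D.antitone (i := i + 2) (j := j) (k := y) (by omega) hjy.le (by omega)
      have h4 := hhi j (by omega) (by omega)
      have h5 := hstep j
      rcases hM j (by omega) (by omega) with h6 | h6 <;> rw [h6] at h5 <;> push_cast at h5
      · left; linarith [hby.2]
      · right; linarith [hby.2]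
    · right
      have h3 := D.antitone (i := i + 1) (j := y) (k := j) (by omega) hjy (by omega)
      have h4 := hlo j (by omega) (by omega)
      linarith [hby.1]
  obtain ⟨z, hz⟩ := sum_signs hsign
  have hs := D.row_sum (i + 1)
  rw [← Finset.sum_range_add_sum_Ico _ (show 2 ≤ n by omega), hz] at hs
  simp only [sum_range_succ, range_zero, sum_empty, Nat.cast_zero, add_zero, Nat.cast_one,
    D.diag, D.edge, h1, Nat.card_Ico] at hs
  have hs' : (2 : ℤ) + (n - 2 : ℕ) + 2 * z = 0 := by
    have : ((2 : ℤ) + (n - 2 : ℕ) + 2 * z : ℝ) = 0 := by push_cast at hs ⊢; linarith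
    exact_mod_cast this
  obtain ⟨m, hm⟩ := hodd
  omega

theorem edge_eq_of_exchange_adjacent (D : CyclicBiresidue n b c M) {i : ℤ}
    (h1 : M (i + 1) i = M i (i + 2)) (h2 : 0 ≤ M i (i + 2)) : c (i + 1) = c i := by
  have h := D.exchange_adjacent i
  rw [h1] at h
  have : (0 : ℝ) ≤ M i (i + 2) := by exact_mod_cast h2
  exact mul_right_cancel₀ (by linarith) h

/-- After a minimal edge, the next edge can only be larger if the minimal edge raises the next
vertex but one exactly once. -/
theorem incr_of_edge_lt (D : CyclicBiresidue n b c M) (hn : 5 ≤ n) (hmin : ∀ j, 1 ≤ c j) {i : ℤ}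
    (hi : c i = 1) (hi' : c (i + 1) ≠ 1) : M i (i + 2) = 1 ∧ M (i + 1) i = 0 ∧ c (i + 1) = 2 := by
  have hgt : 1 < c (i + 1) := lt_of_le_of_ne (hmin _) (Ne.symm hi')
  have ex0 := D.exchange_adjacent i
  rw [hi] at ex0
  have nn1 : 0 ≤ M (i + 1) i := by
    rw [← D.incr_periodic_right]; exact D.incr_nonneg _ _ (by omega) (by omega)
  have nn1' : (0 : ℝ) ≤ M (i + 1) i := by exact_mod_cast nn1
  have u0 := D.incr_nonneg i (i + 2) (by omega) (by omega)
  have u2 := D.incr_le_two (i := i) (x := i + 2) ⟨by omega, by omega⟩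
  have hlt : M (i + 1) i < M i (i + 2) := by
    have : (M (i + 1) i : ℝ) < M i (i + 2) := by nlinarith
    exact_mod_cast this
  have hu : M i (i + 2) = 1 ∨ M i (i + 2) = 2 := by omega
  rcases hu with hu | hu
  · have hx : M (i + 1) i = 0 := by omega
    refine ⟨hu, hx, ?_⟩
    rw [hu, hx] at ex0
    push_cast at ex0; linarith
  -- The whole increment 2 now sits at `i + 2`. The exchange identities leave finitely many values
  -- for the next edges; the last surviving chain is 1, 3/2, 1, and it forces `c (i + 3) < 1`.
  exfalso
  have e1 : i + 1 + 1 = i + 2 := by ring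
  have e2 : i + 1 + 2 = i + 3 := by ring
  have e3 : i + 2 + 1 = i + 3 := by ring
  have e4 : i + 2 + 2 = i + 4 := by ring
  have e5 : i + 3 + 1 = i + 4 := by ring
  have ex1 := D.exchange i (i + 2)
  have ex2 := D.exchange_adjacent (i + 1)
  have ex3 := D.exchange_adjacent (i + 2)
  have ex4 := D.exchange (i + 1) (i + 3)
  have h3 : M i (i + 3) = 0 := by
    have h4 := D.incr_add_le (i := i) (x := i + 2) (y := i + 3) ⟨by omega, by omega⟩
      ⟨by omega, by omega⟩ (by omega)
    have h5 := D.incr_nonneg i (i + 3) (by omega) (by omega)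
    omega
  have A0 : 0 ≤ M (i + 2) i := by
    rw [← D.incr_periodic_right]; exact D.incr_nonneg _ _ (by omega) (by omega)
  have B0 : 0 ≤ M (i + 2) (i + 1) := by
    rw [← D.incr_periodic_right]; exact D.incr_nonneg _ _ (by omega) (by omega)
  have AB : M (i + 2) i + M (i + 2) (i + 1) ≤ 2 := by
    rw [← D.incr_periodic_right _ i, ← D.incr_periodic_right _ (i + 1)]
    exact D.incr_add_le ⟨by omega, by omega⟩ ⟨by omega, by omega⟩ (by omega)
  rw [e3, hi, h3, hu] at ex1
  rw [e1, e2] at ex2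
  rw [e3, e4] at ex3
  rw [e5, e1] at ex4
  have c2 := hmin (i + 2)
  have c3 := hmin (i + 3)
  have hle := D.edge_le_add i
  rw [hi] at hle
  have v0 : 0 ≤ M (i + 1) (i + 3) := D.incr_nonneg _ _ (by omega) (by omega)
  have v2 : M (i + 1) (i + 3) ≤ 2 := D.incr_le_two ⟨by omega, by omega⟩
  have w0 : 0 ≤ M (i + 2) (i + 4) := D.incr_nonneg _ _ (by omega) (by omega)
  have hAB : M (i + 2) i = 0 ∧ (M (i + 2) (i + 1) = 1 ∨ M (i + 2) (i + 1) = 2) := by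
    have : M (i + 2) i < M (i + 2) (i + 1) := by
      have : (M (i + 2) i : ℝ) < M (i + 2) (i + 1) := by push_cast at ex1; nlinarith
      exact_mod_cast this
    omega
  obtain ⟨hA, hB⟩ := hAB
  rw [hA] at ex1
  have hx : M (i + 1) i = 0 ∨ M (i + 1) i = 1 := by omega
  have hB2 : M (i + 2) (i + 1) = 2 := by
    rcases hB with hB | hB
    · exfalso
      rw [hB] at ex1 ex2
      rw [hu] at ex0
      push_cast at ex0 ex1 ex2
      have c2' : c (i + 2) = 2 := by linarith
      rw [c2'] at ex2
      have hv : M (i + 1) (i + 3) = 0 ∨ M (i + 1) (i + 3) = 1 ∨ M (i + 1) (i + 3) = 2 := by omega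
      rcases hx with hx | hx <;> rw [hx] at ex0 <;> push_cast at ex0 <;>
        rcases hv with hv | hv | hv <;> rw [hv] at ex2 <;> push_cast at ex2 <;> linarith
    · exact hB
  rw [hB2] at ex1 ex2
  rw [hu] at ex0
  push_cast at ex0 ex1 ex2
  have c2' : c (i + 2) = 1 := by linarith
  rw [c2'] at ex2 hle
  have hx1 : M (i + 1) i = 1 := by
    rcases hx with hx | hx
    · rw [hx] at ex0; push_cast at ex0; linarith
    · exact hx
  rw [hx1] at ex0
  push_cast at ex0
  have c1 : c (i + 1) = 3 / 2 := by linarith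
  rw [c1] at ex2
  have hv : M (i + 1) (i + 3) = 1 := by
    have : (M (i + 1) (i + 3) : ℝ) = 1 := by linarith
    exact_mod_cast this
  have h4 : M (i + 1) (i + 4) = 0 := by
    have h5 := D.incr_add_add_le (i := i + 1) (x := i + n) (y := i + 3) (z := i + 4)
      ⟨by omega, by omega⟩ ⟨by omega, by omega⟩ ⟨by omega, by omega⟩ (by omega) (by omega)
      (by omega)
    rw [D.incr_periodic_right] at h5
    have := D.incr_nonneg (i + 1) (i + 4) (by omega) (by omega)
    omega
  have h5 : M (i + 2) (i + 4) = 0 := by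
    have h5 := D.incr_add_le (i := i + 2) (x := i + 1 + n) (y := i + 4)
      ⟨by omega, by omega⟩ ⟨by omega, by omega⟩ (by omega)
    rw [D.incr_periodic_right] at h5
    omega
  have E0 : 0 ≤ M (i + 3) (i + 1) := by
    rw [← D.incr_periodic_right]; exact D.incr_nonneg _ _ (by omega) (by omega)
  rw [h5, c2'] at ex3
  rw [h4, hv, c1] at ex4
  have E0' : (0 : ℝ) ≤ M (i + 3) (i + 1) := by exact_mod_cast E0
  have F1 : 1 ≤ M (i + 3) (i + 2) := by
    have : (0 : ℝ) < M (i + 3) (i + 2) := by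
      push_cast at ex4
      by_contra hF
      nlinarith
    exact_mod_cast this
  have F1' : (1 : ℝ) ≤ M (i + 3) (i + 2) := by exact_mod_cast F1
  push_cast at ex3
  nlinarith

/-- The start of a run of larger edges. -/
theorem edges_of_edge_lt (D : CyclicBiresidue n b c M) (hodd : Odd n) (hn : 5 ≤ n)
    (hmin : ∀ j, 1 ≤ c j) {i : ℤ} (hi : c i = 1) (hi' : c (i + 1) ≠ 1) :
    c (i - 1) = 1 ∧ c (i + 2) = 2 ∧ c (i + 3) = 1 ∧ M i (i + 3) = 1 ∧ M (i + 3) (i + 1) = 1 ∧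
      M (i + 3) (i + 2) = 1 ∧ M (i + 2) (i + 4) = 0 ∧ M (i + 2) i = M (i + 2) (i + 1) ∧
      M (i + 1) (i + 3) = M (i + 2) (i + 1) := by
  obtain ⟨hu, hx, h1⟩ := D.incr_of_edge_lt hn hmin hi hi'
  have e1 : i + 1 + 1 = i + 2 := by ring
  have e2 : i + 1 + 2 = i + 3 := by ring
  have e3 : i + 2 + 1 = i + 3 := by ring
  have e4 : i + 2 + 2 = i + 4 := by ring
  have e5 : i + 3 + 1 = i + 4 := by ring
  have e6 : i - 1 + 1 = i := by ring
  have e7 : i - 1 + 2 = i + 1 := by ring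
  have ex1 := D.exchange i (i + 2)
  have ex2 := D.exchange_adjacent (i + 1)
  have ex3 := D.exchange_adjacent (i + 2)
  have ex4 := D.exchange i (i + 3)
  have ex5 := D.exchange_adjacent (i - 1)
  rw [e3, hi, hu] at ex1
  rw [e1, e2, h1] at ex2
  rw [e3, e4] at ex3
  rw [e5, hi] at ex4
  rw [e6, e7, hi] at ex5
  have c2 := hmin (i + 2)
  have c3 := hmin (i + 3)
  have A0 : 0 ≤ M (i + 2) i := by
    rw [← D.incr_periodic_right]; exact D.incr_nonneg _ _ (by omega) (by omega)
  have B0 : 0 ≤ M (i + 2) (i + 1) := by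
    rw [← D.incr_periodic_right]; exact D.incr_nonneg _ _ (by omega) (by omega)
  have AB : M (i + 2) i + M (i + 2) (i + 1) ≤ 2 := by
    rw [← D.incr_periodic_right _ i, ← D.incr_periodic_right _ (i + 1)]
    exact D.incr_add_le ⟨by omega, by omega⟩ ⟨by omega, by omega⟩ (by omega)
  have v0 : 0 ≤ M i (i + 3) := D.incr_nonneg _ _ (by omega) (by omega)
  have v1 : M i (i + 2) + M i (i + 3) ≤ 2 :=
    D.incr_add_le ⟨by omega, by omega⟩ ⟨by omega, by omega⟩ (by omega)
  -- Parity is used only here: without an increment at `i + 3`, the exchange identity would force `c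
  -- (i + 2) = 1`.
  have hn121 : c (i + 2) ≠ 1 := fun h => D.not_one_two_one hodd hi h1 h
  have hv : M i (i + 3) = 1 := by
    by_contra hv
    have hv : M i (i + 3) = 0 := by omega
    rw [hv] at ex1
    have hlt : M (i + 2) i < M (i + 2) (i + 1) := by
      have : (M (i + 2) i : ℝ) < M (i + 2) (i + 1) := by push_cast at ex1; nlinarith
      exact_mod_cast this
    have hlt' : (M (i + 2) i : ℝ) + 1 ≤ M (i + 2) (i + 1) := by exact_mod_cast hlt
    push_cast at ex1
    exact hn121 (by nlinarith)
  rw [hv] at ex1 ex4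
  have hAB : M (i + 2) i = M (i + 2) (i + 1) := by
    have : (M (i + 2) i : ℝ) = M (i + 2) (i + 1) := by push_cast at ex1; nlinarith
    exact_mod_cast this
  have z4 : M i (i + 4) = 0 := by
    have h4 := D.incr_add_add_le (i := i) (x := i + 2) (y := i + 3) (z := i + 4)
      ⟨by omega, by omega⟩ ⟨by omega, by omega⟩ ⟨by omega, by omega⟩ (by omega) (by omega)
      (by omega)
    have := D.incr_nonneg i (i + 4) (by omega) (by omega)
    omega
  have z5 : M i (i - 1) = 0 := by
    have h4 := D.incr_add_add_le (i := i) (x := i + 2) (y := i + 3) (z := i - 1 + n)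
      ⟨by omega, by omega⟩ ⟨by omega, by omega⟩ ⟨by omega, by omega⟩ (by omega) (by omega)
      (by omega)
    have := D.incr_nonneg i (i - 1 + n) (by omega) (by omega)
    rw [D.incr_periodic_right] at this h4
    omega
  rw [z4] at ex4
  rw [z5] at ex5
  have G0 : 0 ≤ M (i + 3) i := by
    rw [← D.incr_periodic_right]; exact D.incr_nonneg _ _ (by omega) (by omega)
  have K0 : 0 ≤ M (i + 3) (i + 2) := by
    rw [← D.incr_periodic_right]; exact D.incr_nonneg _ _ (by omega) (by omega)
  have HK : M (i + 3) (i + 1) + M (i + 3) (i + 2) ≤ 2 := by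
    rw [← D.incr_periodic_right _ (i + 1), ← D.incr_periodic_right _ (i + 2)]
    exact D.incr_add_le ⟨by omega, by omega⟩ ⟨by omega, by omega⟩ (by omega)
  have hlt : M (i + 3) i < M (i + 3) (i + 1) := by
    have : (M (i + 3) i : ℝ) < M (i + 3) (i + 1) := by push_cast at ex4; nlinarith
    exact_mod_cast this
  have hlt' : (M (i + 3) i : ℝ) + 1 ≤ M (i + 3) (i + 1) := by exact_mod_cast hlt
  have c3' : c (i + 3) = 1 := by push_cast at ex4; nlinarith
  rw [c3'] at ex3
  have hc1 : c (i - 1) = 1 := by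
    have h4 := hmin (i - 1)
    have h5 := D.incr_nonneg (i - 1) (i + 1) (by omega) (by omega)
    have h5' : (0 : ℝ) ≤ M (i - 1) (i + 1) := by exact_mod_cast h5
    push_cast at ex5; nlinarith
  have w0 : 0 ≤ M (i + 2) (i + 4) := D.incr_nonneg _ _ (by omega) (by omega)
  have w0' : (0 : ℝ) ≤ M (i + 2) (i + 4) := by exact_mod_cast w0
  have c2gt : 1 < c (i + 2) := lt_of_le_of_ne c2 (Ne.symm hn121)
  have hK : M (i + 3) (i + 2) = 1 := by
    have : (0 : ℝ) < M (i + 3) (i + 2) := by nlinarith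
    have : 0 < M (i + 3) (i + 2) := by exact_mod_cast this
    omega
  rw [hK] at ex3
  have hw : M (i + 2) (i + 4) = 0 := by
    have : (M (i + 2) (i + 4) : ℝ) < 1 := by push_cast at ex3; nlinarith
    have : M (i + 2) (i + 4) < 1 := by exact_mod_cast this
    omega
  rw [hw] at ex3
  have c2' : c (i + 2) = 2 := by push_cast at ex3; linarith
  rw [c2'] at ex2
  have hD : M (i + 1) (i + 3) = M (i + 2) (i + 1) := by
    have : (M (i + 1) (i + 3) : ℝ) = M (i + 2) (i + 1) := by linarith
    exact_mod_cast this
  exact ⟨hc1, c2', c3', hv, by omega, hK, hw, hAB, hD⟩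

/-! ### The rows around a run of longer edges -/

theorem row_sum_split (D : CyclicBiresidue n b c M) (i : ℤ) {m : ℕ} (h1 : 1 ≤ m) (h2 : m ≤ n) :
    ∑ d ∈ Ico 1 m, b i (i + d) + ∑ d ∈ Ico m n, b i (i + d) = 0 := by
  have hs := D.row_sum i
  rw [← Finset.sum_range_add_sum_Ico _ (h1.trans h2)] at hs
  simp only [sum_range_succ, range_zero, sum_empty, Nat.cast_zero, add_zero, D.diag] at hs
  rw [Finset.sum_Ico_consecutive _ h1 h2]
  linarith

/-- There are `2 * h` signs in decreasing order with sum zero, so the change of sign occurs exactly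
in the middle; one more sign on either side would unbalance the sum. -/
theorem row_of_signs (D : CyclicBiresidue n b c M) {h : ℕ} (hh : n = 2 * h + 1) {i : ℤ}
    (hs : ∀ j, i < j → j < i + n → b i j = 1 ∨ b i j = -1) :
    (∀ j, i < j → j ≤ i + h → b i j = 1) ∧ ∀ j, i + h < j → j < i + n → b i j = -1 := by
  have hn := D.three_le
  have hi : ∀ j, i < j → j < i + n → b i j ≤ 1 ∧ -1 ≤ b i j := by
    intro j h1 h2
    rcases hs j h1 h2 with h3 | h3 <;> rw [h3] <;> norm_num
  have hneg : b i (i + h + 1) = -1 := by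
    refine (hs _ (by omega) (by omega)).resolve_left fun hone => ?_
    have h0 := D.row_sum_split i (m := h + 2) (by omega) (by omega)
    have h1 : (Ico 1 (h + 2)).card • (1 : ℝ) ≤ ∑ d ∈ Ico 1 (h + 2), b i (i + d) := by
      refine card_nsmul_le_sum _ _ _ fun d hd => ?_
      rw [mem_Ico] at hd
      rw [← hone]
      exact D.antitone (by omega) (by omega) (by omega)
    have h2 : (Ico (h + 2) n).card • (-1 : ℝ) ≤ ∑ d ∈ Ico (h + 2) n, b i (i + d) := by
      refine card_nsmul_le_sum _ _ _ fun d hd => ?_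
      rw [mem_Ico] at hd
      exact (hi _ (by omega) (by omega)).2
    rw [Nat.card_Ico, nsmul_eq_mul] at h1 h2
    rw [show n - (h + 2) = h - 1 by omega, Nat.cast_sub (by omega)] at h2
    rw [show h + 2 - 1 = h + 1 by omega] at h1
    push_cast at h1 h2
    linarith
  have hpos : b i (i + h) = 1 := by
    refine (hs _ (by omega) (by omega)).resolve_right fun hone => ?_
    have h0 := D.row_sum_split i (m := h) (by omega) (by omega)
    have h1 : ∑ d ∈ Ico 1 h, b i (i + d) ≤ (Ico 1 h).card • (1 : ℝ) := by
      refine sum_le_card_nsmul _ _ _ fun d hd => ?_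
      rw [mem_Ico] at hd
      exact (hi _ (by omega) (by omega)).1
    have h2 : ∑ d ∈ Ico h n, b i (i + d) ≤ (Ico h n).card • (-1 : ℝ) := by
      refine sum_le_card_nsmul _ _ _ fun d hd => ?_
      rw [mem_Ico] at hd
      rw [← hone]
      exact D.antitone (by omega) (by omega) (by omega)
    rw [Nat.card_Ico, nsmul_eq_mul] at h1 h2
    rw [show n - h = h + 1 by omega] at h2
    rw [Nat.cast_sub (by omega)] at h1
    push_cast at h1 h2
    linarith
  constructor
  · intro j h1 h2
    have h3 := D.antitone h1 h2 (by omega)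
    have h4 := (hi j h1 (by omega)).1
    linarith
  · intro j h1 h2
    have h3 := D.antitone (i := i) (j := i + h + 1) (k := j) (by omega) (by omega) h2
    have h4 := (hi j (by omega) h2).2
    linarith

/-- The shape of the five rows after a minimal edge followed by a larger one. -/
structure Run (h : ℕ) (b : ℤ → ℤ → ℝ) (c : ℤ → ℝ) (M : ℤ → ℤ → ℤ) (i : ℤ) : Prop where
  edge_prev : c (i - 1) = 1
  edge_one : c (i + 1) = 2
  edge_two : c (i + 2) = 2
  edge_three : c (i + 3) = 1
  row_pos : ∀ j, i < j → j ≤ i + h → b i j = 1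
  row_neg : ∀ j, i + h < j → j < i + (2 * h + 1) → b i j = -1
  incr_zero : M i (i + 2) = 1 ∧ M i (i + 3) = 1
  incr_one : M (i + 1) (i + h + 1) = 1 ∧ M (i + 1) (i + h + 2) = 1
  incr_two : M (i + 2) (i + h + 3) = 1 ∧ M (i + 2) (i + h + 4) = 1
  incr_three : M (i + 3) (i + 1) = 1 ∧ M (i + 3) (i + 2) = 1
  opposite : h = 2 ∨ c (i + h) = 2 ∧ M (i + h) i = 1 ∧ M (i + h) (i + 1) = 1

/-- The local data near `i` leave one free bit, `M (i + 2) (i + 1)`. The value 1 forces `n = 5`.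
With the value 0, the jumps by 2 must go from -1 to 1, so the rows consist of signs away from the
run, and monotonicity puts the increments at the first negative positions. -/
theorem run_of_edge_lt (D : CyclicBiresidue n b c M) {h : ℕ} (hh : n = 2 * h + 1) (hn : 5 ≤ n)
    (hmin : ∀ j, 1 ≤ c j) {i : ℤ} (hi : c i = 1) (hi' : c (i + 1) ≠ 1) : Run h b c M i := by
  obtain ⟨hu, hx, h1⟩ := D.incr_of_edge_lt hn hmin hi hi'
  obtain ⟨hp, h2, h3, hu3, g1, g2, w, hAB, hD⟩ := D.edges_of_edge_lt ⟨h, hh⟩ hn hmin hi hi'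
  have st0 := D.step i
  have st1 := D.step (i + 1)
  have st2 := D.step (i + 2)
  rw [hi] at st0
  rw [show i + 1 + 1 = i + 2 by ring, h1] at st1
  rw [show i + 2 + 1 = i + 3 by ring, h2] at st2
  have le2 : ∀ j, i + 2 < j → j < i + 2 + n → b (i + 2) j ≤ 2 := by
    intro j hj hj'; have := D.le_edge hj hj'; rwa [h2] at this
  have le3 : ∀ j, i + 3 < j → j < i + 3 + n → b (i + 3) j ≤ 1 := by
    intro j hj hj'; have := D.le_edge hj hj'; rwa [h3] at this
  have ge1 : ∀ j, i + 1 < j → j < i + 1 + n → -1 ≤ b (i + 1) j := by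
    intro j hj hj'; have := D.neg_edge_le hj hj'; rwa [hi] at this
  have ge0 : ∀ j, i < j → j < i + n → -1 ≤ b i j := by
    intro j hj hj'
    have := D.neg_edge_le (i := i - 1) (j := j) (by omega) (by omega)
    rwa [hp, sub_add_cancel] at this
  have e1 : b (i + 1) i = -1 := by rw [D.edge_back, hi]
  have e2 : b (i + 2) i = -1 := by rw [st1, e1, hx]; norm_num
  have b01 : b i (i + 1) = 1 := by rw [D.edge, hi]
  have b12 : b (i + 1) (i + 2) = 2 := by
    rw [show i + 2 = i + 1 + 1 by ring, D.edge, h1]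
  have b23 : b (i + 2) (i + 3) = 2 := by
    rw [show i + 3 = i + 2 + 1 by ring, D.edge, h2]
  have b02 : b i (i + 2) = 1 := by
    have := st0 (i + 2); rw [hu, b12] at this; push_cast at this; linarith
  have A0 : 0 ≤ M (i + 2) i := by
    rw [← D.incr_periodic_right]; exact D.incr_nonneg _ _ (by omega) (by omega)
  have AB : M (i + 2) i + M (i + 2) (i + 1) ≤ 2 := by
    rw [← D.incr_periodic_right _ i, ← D.incr_periodic_right _ (i + 1)]
    exact D.incr_add_le ⟨by omega, by omega⟩ ⟨by omega, by omega⟩ (by omega)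
  have hcase : M (i + 2) (i + 1) = 1 ∨ M (i + 2) (i + 1) = 0 := by omega
  rcases hcase with hc | hc
  -- Row `i + 3` is then 1 up to column `i + n`, leaving only the entries -2 at `i + 1` and 0 at `i
  -- + 2`: exactly two ones fit, so `n = 5`.
  · rw [hc] at hAB hD
    have e3 : b (i + 3) (i + n) = 1 := by
      rw [D.periodic_right, st2, e2, hAB]; norm_num
    have h0 := D.row_sum_split (i + 3) (m := n - 2) (by omega) (by omega)
    have s1 : ∑ d ∈ Ico 1 (n - 2), b (i + 3) (i + 3 + d) = ∑ d ∈ Ico 1 (n - 2), (1 : ℝ) := by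
      refine sum_congr rfl fun d hd => ?_
      rw [mem_Ico] at hd
      refine le_antisymm (le3 _ (by omega) (by omega)) ?_
      rw [← e3]
      exact D.antitone (by omega) (by omega) (by omega)
    have s2 : ∑ d ∈ Ico (n - 2) n, b (i + 3) (i + 3 + d) = -2 := by
      rw [Finset.sum_Ico_eq_sum_range, show n - (n - 2) = 2 by omega]
      simp only [sum_range_succ, range_zero, sum_empty]
      rw [show i + 3 + ((n - 2 + 0 : ℕ) : ℤ) = i + 1 + n by omega,
        show i + 3 + ((n - 2 + 1 : ℕ) : ℤ) = i + 2 + n by omega, D.periodic_right,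
        D.periodic_right, st2 (i + 1), hc, show i + 2 = i + 1 + 1 by ring, D.edge_back, h1,
        show i + 3 = i + 1 + 1 + 1 by ring, D.edge_back, show i + 1 + 1 = i + 2 by ring, h2]
      norm_num
    rw [s1, s2, sum_const, Nat.card_Ico, nsmul_eq_mul, mul_one] at h0
    have h5 : n = 5 := by
      have : ((n - 2 - 1 : ℕ) : ℝ) = (2 : ℕ) := by push_cast; linarith
      have := Nat.cast_injective this
      omega
    have hh2 : h = 2 := by omega
    subst h5 hh2
    have b13 : b i (i + 4) = -1 := by
      rw [show i + 4 = i - 1 + (5 : ℕ) by push_cast; ring, D.periodic_right]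
      have := D.edge_back (i - 1)
      rwa [sub_add_cancel, hp] at this
    have hs := D.row_sum i
    simp only [sum_range_succ, range_zero, sum_empty, Nat.cast_zero, Nat.cast_one, add_zero,
      D.diag, Nat.cast_ofNat] at hs
    rw [b01, b02, b13] at hs
    have hrow := D.row_of_signs (h := 2) rfl (i := i) (by
      intro j hj hj'
      have : j = i + 1 ∨ j = i + 2 ∨ j = i + 3 ∨ j = i + 4 := by omega
      rcases this with rfl | rfl | rfl | rfl
      · left; exact b01
      · left; exact b02
      · right; linarith
      · right; exact b13)
    have hm4 : M (i + 1) (i + 4) = 1 := by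
      have hs := D.incr_sum_Ico (i + 1)
      rw [Finset.sum_Ico_eq_sum_range] at hs
      simp only [sum_range_succ, range_zero, sum_empty, Nat.reduceSub] at hs
      rw [show i + 1 + ((2 + 0 : ℕ) : ℤ) = i + 3 by push_cast; ring,
        show i + 1 + ((2 + 1 : ℕ) : ℤ) = i + 4 by push_cast; ring,
        show i + 1 + ((2 + 2 : ℕ) : ℤ) = i + (5 : ℕ) by push_cast; ring,
        D.incr_periodic_right] at hs
      omega
    refine ⟨hp, h1, h2, h3, hrow.1, fun j hj hj' => hrow.2 j hj (by omega), ⟨hu, hu3⟩, ⟨?_, ?_⟩,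
      ⟨?_, ?_⟩, ⟨g1, g2⟩, Or.inl rfl⟩
    · rw [show i + ((2 : ℕ) : ℤ) + 1 = i + 3 by push_cast; ring, hD]
    · rw [show i + ((2 : ℕ) : ℤ) + 2 = i + 4 by push_cast; ring, hm4]
    · rw [show i + ((2 : ℕ) : ℤ) + 3 = i + (5 : ℕ) by push_cast; ring, D.incr_periodic_right,
        hAB]
    · rw [show i + ((2 : ℕ) : ℤ) + 4 = i + 1 + (5 : ℕ) by push_cast; ring,
        D.incr_periodic_right, hc]
  rw [hc] at hAB hD
  -- positions of the increments in the row `i + 2`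
  have chip2 : ∀ y, i + 3 < y → y < i + 2 + n → 1 ≤ M (i + 2) y →
      i + 4 < y ∧ y < i + n ∧ M (i + 2) y = 1 ∧ b (i + 2) y = -1 ∧ b (i + 3) y = 1 := by
    intro y hy hy' hM
    have n1 : y ≠ i + n := by
      rintro rfl; rw [D.incr_periodic_right] at hM; omega
    have n2 : y ≠ i + 1 + n := by
      rintro rfl; rw [D.incr_periodic_right] at hM; omega
    have n3 : y ≠ i + 4 := by rintro rfl; omega
    have k1 := D.antitone (i := i + 2) (j := y) (k := i + n) (by omega) (by omega) (by omega)
    rw [D.periodic_right, e2] at k1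
    have k2 := st2 y
    have k3 := le3 y (by omega) (by omega)
    have k4 : (1 : ℝ) ≤ M (i + 2) y := by exact_mod_cast hM
    have k5 : (M (i + 2) y : ℝ) = 1 := by linarith
    refine ⟨by omega, by omega, by exact_mod_cast k5, by linarith, by linarith⟩
  obtain ⟨y, hy1, hy2, -, hy⟩ := D.exists_incr_pos (i + 2) (i + 2) (by rw [D.incr_self]; omega)
  obtain ⟨hy3, hy4, hyM, hyb2, hyb3⟩ := chip2 y (by omega) hy2 hy
  obtain ⟨z, hz1, hz2, hzy, hz⟩ := D.exists_incr_pos (i + 2) y (by omega)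
  obtain ⟨hz3, hz4, hzM, hzb2, hzb3⟩ := chip2 z (by omega) hz2 hz
  have sg2 : ∀ j, i + 4 ≤ j → j ≤ i + n → b (i + 2) j = 1 ∨ b (i + 2) j = -1 := by
    intro j hj hj'
    rcases le_or_gt j y with hjy | hjy
    · have k1 := D.antitone (i := i + 3) (j := j) (k := y) (by omega) hjy (by omega)
      have k2 := le3 j (by omega) (by omega)
      have k3 := st2 j
      have k4 := D.incr_nonneg (i + 2) j (by omega) (by omega)
      have k5 := D.incr_le_two (i := i + 2) (x := j) ⟨by omega, by omega⟩
      have k6 : M (i + 2) j = 0 ∨ M (i + 2) j = 1 := by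
        rcases k4.lt_or_eq with k7 | k7
        · right; exact (chip2 j (by omega) (by omega) (by omega)).2.2.1
        · left; omega
      rcases k6 with k6 | k6 <;> rw [k6] at k3 <;> push_cast at k3
      · left; linarith
      · right; linarith
    · right
      have k1 := D.antitone (i := i + 2) (j := y) (k := j) (by omega) hjy.le (by omega)
      have k2 := D.antitone (i := i + 2) (j := j) (k := i + n) (by omega) hj' (by omega)
      rw [D.periodic_right, e2] at k2
      linarith
  have sg1 : ∀ j, i + 4 ≤ j → j ≤ i + n →
      (b (i + 1) j = 1 ∧ M (i + 1) j = 0) ∨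
      (b (i + 1) j = -1 ∧ (M (i + 1) j = 0 ∨ M (i + 1) j = 1)) := by
    intro j hj hj'
    have k1 := ge1 j (by omega) (by omega)
    have k2 := D.incr_nonneg (i + 1) j (by omega) (by omega)
    have k3 := st1 j
    have k4 : (0 : ℝ) ≤ M (i + 1) j := by exact_mod_cast k2
    rcases sg2 j hj hj' with k5 | k5
    · have k6 : (M (i + 1) j : ℝ) ≤ 1 := by linarith
      have k7 : M (i + 1) j ≤ 1 := by exact_mod_cast k6
      have k8 : M (i + 1) j = 0 ∨ M (i + 1) j = 1 := by omega
      rcases k8 with k8 | k8 <;> rw [k8] at k3 <;> push_cast at k3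
      · left; exact ⟨by linarith, k8⟩
      · right; exact ⟨by linarith, Or.inr k8⟩
    · have k6 : (M (i + 1) j : ℝ) ≤ 0 := by linarith
      have k7 : M (i + 1) j ≤ 0 := by exact_mod_cast k6
      have k8 : M (i + 1) j = 0 := by omega
      rw [k8] at k3; push_cast at k3
      right; exact ⟨by linarith, Or.inl k8⟩
  have row01 : ∀ j, i + 4 ≤ j → j < i + n → b (i + 1) j = b i j := by
    intro j hj hj'
    have k1 := D.incr_add_add_le (i := i) (x := i + 2) (y := i + 3) (z := j)
      ⟨by omega, by omega⟩ ⟨by omega, by omega⟩ ⟨by omega, by omega⟩ (by omega) (by omega)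
      (by omega)
    have k2 := D.incr_nonneg i j (by omega) (by omega)
    have k3 : M i j = 0 := by omega
    rw [st0, k3]; norm_num
  have b03 : b i (i + 3) = 1 := by
    have k1 := st1 (i + 3)
    have k2 := st0 (i + 3)
    rw [b23, hD] at k1
    rw [hu3] at k2
    push_cast at k1 k2; linarith
  have hrow := D.row_of_signs hh (i := i) (by
    intro j hj hj'
    rcases lt_or_ge j (i + 4) with hj4 | hj4
    · left
      have : j = i + 1 ∨ j = i + 2 ∨ j = i + 3 := by omega
      rcases this with rfl | rfl | rfl
      · exact b01
      · exact b02
      · exact b03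
    · rw [← row01 j hj4 hj']
      rcases sg1 j hj4 hj'.le with k | k
      · exact Or.inl k.1
      · exact Or.inr k.1)
  obtain ⟨rp, rn⟩ := hrow
  have h3le : 3 ≤ h := by
    by_contra hcon
    have := rn (i + 3) (by omega) (by omega)
    rw [b03] at this; norm_num at this
  have chip1 : ∀ x, i + 2 < x → x < i + 1 + n → 1 ≤ M (i + 1) x →
      i + h < x ∧ x < i + n ∧ M (i + 1) x = 1 ∧ b (i + 2) x = 1 := by
    intro x hx1 hx2 hM
    have n1 : x ≠ i + n := by
      rintro rfl; rw [D.incr_periodic_right] at hM; omega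
    have n3 : x ≠ i + 3 := by rintro rfl; omega
    rcases sg1 x (by omega) (by omega) with k | k
    · omega
    · have k1 : M (i + 1) x = 1 := by omega
      refine ⟨?_, by omega, k1, ?_⟩
      · by_contra hcon
        have := rp x (by omega) (by omega)
        rw [← row01 x (by omega) (by omega), k.1] at this
        norm_num at this
      · rw [st1, k.1, k1]; norm_num
  -- After an increment at `x`, row `i + 2` is 1 there, hence at least 1 at every earlier column;
  -- each negative entry of row `i + 1` before `x` must therefore be raised too.
  have fill1 : ∀ x j, i + 2 < x → x < i + 1 + n → 1 ≤ M (i + 1) x → i + h < j → j ≤ x →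
      M (i + 1) j = 1 := by
    intro x j hx1 hx2 hM hj hjx
    obtain ⟨k1, k2, k3, k4⟩ := chip1 x hx1 hx2 hM
    have k5 := D.antitone (i := i + 2) (j := j) (k := x) (by omega) hjx (by omega)
    have k6 := st1 j
    rw [row01 j (by omega) (by omega), rn j hj (by omega)] at k6
    have k7 : (0 : ℝ) < M (i + 1) j := by linarith
    have k8 : 0 < M (i + 1) j := by exact_mod_cast k7
    exact (chip1 j (by omega) (by omega) (by omega)).2.2.1
  obtain ⟨x, hx1, hx2, -, hxM⟩ := D.exists_incr_pos (i + 1) (i + 1) (by rw [D.incr_self]; omega)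
  have m1 := fill1 x (i + h + 1) (by omega) hx2 hxM (by omega)
    (by have := chip1 x (by omega) hx2 hxM; omega)
  obtain ⟨x', hx1', hx2', hxx, hxM'⟩ := D.exists_incr_pos (i + 1) (i + h + 1) (by omega)
  have m2 := fill1 x' (i + h + 2) (by omega) hx2' hxM' (by omega)
    (by have := chip1 x' (by omega) hx2' hxM'; omega)
  have row2p : ∀ j, i + 4 ≤ j → j ≤ i + h + 2 → b (i + 2) j = 1 := by
    intro j hj hj'
    have k1 := (chip1 (i + h + 2) (by omega) (by omega) (by omega)).2
    have k2 := D.antitone (i := i + 2) (j := j) (k := i + h + 2) (by omega) hj' (by omega)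
    rcases sg2 j hj (by omega) with k | k
    · exact k
    · rw [k, k1.2.2] at k2; norm_num at k2
  have row2n : ∀ j, i + h + 2 < j → j < i + n → b (i + 2) j = -1 := by
    intro j hj hj'
    have k1 := D.incr_add_add_le (i := i + 1) (x := i + h + 1) (y := i + h + 2) (z := j)
      ⟨by omega, by omega⟩ ⟨by omega, by omega⟩ ⟨by omega, by omega⟩ (by omega) (by omega)
      (by omega)
    have k2 := D.incr_nonneg (i + 1) j (by omega) (by omega)
    have k3 : M (i + 1) j = 0 := by omega
    rw [st1, row01 j (by omega) hj', rn j (by omega) hj', k3]; norm_num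
  have low2 : ∀ y, i + 3 < y → y < i + 2 + n → 1 ≤ M (i + 2) y → i + h + 2 < y := by
    intro y hy hy' hM
    obtain ⟨k1, k2, k3, k4, k5⟩ := chip2 y hy hy' hM
    by_contra hcon
    rw [row2p y (by omega) (by omega)] at k4
    norm_num at k4
  have fill2 : ∀ x j, i + 3 < x → x < i + 2 + n → 1 ≤ M (i + 2) x → i + h + 2 < j → j ≤ x →
      M (i + 2) j = 1 := by
    intro x j hx1 hx2 hM hj hjx
    obtain ⟨k1, k2, k3, k4, k5⟩ := chip2 x hx1 hx2 hM
    have k6 := D.antitone (i := i + 3) (j := j) (k := x) (by omega) hjx (by omega)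
    have k7 := st2 j
    rw [row2n j hj (by omega)] at k7
    have k8 : (0 : ℝ) < M (i + 2) j := by linarith
    have k9 : 0 < M (i + 2) j := by exact_mod_cast k8
    exact (chip2 j (by omega) (by omega) (by omega)).2.2.1
  have m3 := fill2 y (i + h + 3) (by omega) hy2 hy (by omega)
    (by have := low2 y (by omega) hy2 hy; omega)
  obtain ⟨y', hy1', hy2', hyy, hyM'⟩ := D.exists_incr_pos (i + 2) (i + h + 3) (by omega)
  have hyl := low2 y' (by omega) hy2' hyM'
  have m4 := fill2 y' (i + h + 4) (by omega) hy2' hyM' (by omega) (by omega)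
  have hyl' := chip2 y' (by omega) hy2' hyM'
  have h4le : 4 ≤ h := by omega
  refine ⟨hp, h1, h2, h3, rp, fun j hj hj' => rn j hj (by omega), ⟨hu, hu3⟩, ⟨m1, m2⟩, ⟨m3, m4⟩,
    ⟨g1, g2⟩, Or.inr ?_⟩
  -- Rows `i` and `i + 1` both fall from 1 to -1 across the edge `i + h`. Its increments at `i` and
  -- `i + 1` are thus equal and non-zero with sum at most 2, so both are 1 and the edge is 2.
  have d0 := D.drop i (i + h)
  have d1 := D.drop (i + 1) (i + h)
  rw [row01 _ (by omega) (by omega), row01 _ (by omega) (by omega)] at d1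
  rw [rp (i + h) (by omega) (by omega), rn (i + h + 1) (by omega) (by omega)] at d0 d1
  have f0 : 0 ≤ M (i + h) i := by
    rw [← D.incr_periodic_right]; exact D.incr_nonneg _ _ (by omega) (by omega)
  have f1 : 0 ≤ M (i + h) (i + 1) := by
    rw [← D.incr_periodic_right]; exact D.incr_nonneg _ _ (by omega) (by omega)
  have f2 : M (i + h) i + M (i + h) (i + 1) ≤ 2 := by
    rw [← D.incr_periodic_right _ i, ← D.incr_periodic_right _ (i + 1)]
    exact D.incr_add_le ⟨by omega, by omega⟩ ⟨by omega, by omega⟩ (by omega)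
  have f3 : (M (i + h) i : ℝ) = M (i + h) (i + 1) := by
    refine mul_left_cancel₀ (D.pos (i + h)).ne' ?_
    linarith
  have f4 : M (i + h) i = M (i + h) (i + 1) := by exact_mod_cast f3
  have f5 : M (i + h) i ≠ 0 := by
    intro hf; rw [hf] at d0; norm_num at d0
  have f6 : M (i + h) i = 1 := by omega
  rw [f6] at d0
  push_cast at d0
  exact ⟨by linarith, f6, by omega⟩

/-! ### Propagation of runs around the cycle -/

theorem edge_periodic_mul (D : CyclicBiresidue n b c M) (i t : ℤ) : c (i + t * n) = c i :=
  Function.Periodic.int_mul (f := c) (c := (n : ℤ)) D.edge_periodic t i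

theorem edge_eq_of_three (D : CyclicBiresidue n b c M) (hn : n = 3) (i : ℤ) :
    c (i + 1) = c i := by
  subst hn
  have h : ∀ j, M j (j + 2) = 2 := by
    intro j
    have := D.incr_sum_Ico j
    rw [Finset.sum_Ico_eq_sum_range] at this
    simpa using this
  have h1 := h (i + 1)
  rw [show i + 1 + 2 = i + (3 : ℕ) by push_cast; ring, D.incr_periodic_right] at h1
  exact D.edge_eq_of_exchange_adjacent (by rw [h1, h i]) (by rw [h i]; omega)

theorem edge_const_of_succ (D : CyclicBiresidue n b c M) {i₀ : ℤ}
    (hs : ∀ i, c i = c i₀ → c (i + 1) = c i₀) (i : ℤ) : c i = c i₀ := by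
  have hn := D.three_le
  have h1 : ∀ k : ℕ, c (i₀ + k) = c i₀ := by
    intro k
    induction k with
    | zero => simp
    | succ k ih => rw [Nat.cast_succ, ← add_assoc]; exact hs _ ih
  have h2 := h1 (i - i₀ + |i - i₀| * n).toNat
  -- Adding a multiple of the period turns the integer displacement into a natural number, so that
  -- the forward induction reaches every `i`.
  have h3 : 0 ≤ i - i₀ + |i - i₀| * n := by
    have := neg_abs_le (i - i₀)
    have := abs_nonneg (i - i₀)
    have : (3 : ℤ) ≤ n := by exact_mod_cast hn
    nlinarith
  rwa [Int.toNat_of_nonneg h3, show i₀ + (i - i₀ + |i - i₀| * n) = i + |i - i₀| * n by ring,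
    D.edge_periodic_mul] at h2

/-- A run has exactly two longer edges, so a longer edge is the first or the second of its run. -/
theorem exists_run_start (D : CyclicBiresidue n b c M) {h : ℕ} (hh : n = 2 * h + 1) (hn : 5 ≤ n)
    (hmin : ∀ j, 1 ≤ c j) {i₀ : ℤ} (h0 : c i₀ = 1) {j : ℤ} (hj : c j ≠ 1) :
    (c (j - 1) = 1 ∧ c (j - 1 + 1) ≠ 1) ∨ (c (j - 2) = 1 ∧ c (j - 2 + 1) ≠ 1) := by
  by_cases h1 : c (j - 1) = 1
  · left; exact ⟨h1, by rwa [sub_add_cancel]⟩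
  right
  rw [show j - 2 + 1 = j - 1 by ring]
  refine ⟨?_, h1⟩
  by_contra h2
  -- Three consecutive longer edges extend backwards forever: a unit edge just before them would
  -- start a run whose third successor is again a unit edge. This contradicts `c i₀ = 1`.
  have all : ∀ k : ℕ, c (j - k) ≠ 1 ∧ c (j - k - 1) ≠ 1 ∧ c (j - k - 2) ≠ 1 := by
    intro k
    induction k with
    | zero => simpa using ⟨hj, h1, h2⟩
    | succ k ih =>
      obtain ⟨k1, k2, k3⟩ := ih
      push_cast
      rw [show j - (k + 1 : ℤ) = j - k - 1 by ring, show j - (k : ℤ) - 1 - 1 = j - k - 2 by ring,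
        show j - (k : ℤ) - 1 - 2 = j - k - 3 by ring]
      refine ⟨k2, k3, fun k4 => k1 ?_⟩
      have := (D.run_of_edge_lt hh hn hmin k4
        (by rwa [show j - (k : ℤ) - 3 + 1 = j - k - 2 by ring])).edge_three
      rwa [sub_add_cancel] at this
  have h3 : 0 ≤ j - i₀ + |j - i₀| * n := by
    have := neg_abs_le (j - i₀)
    have := abs_nonneg (j - i₀)
    have : (5 : ℤ) ≤ n := by exact_mod_cast hn
    nlinarith
  have h4 := (all (j - i₀ + |j - i₀| * n).toNat).1
  rw [Int.toNat_of_nonneg h3,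
    show j - (j - i₀ + |j - i₀| * n) = i₀ + (-|j - i₀|) * n by ring, D.edge_periodic_mul] at h4
  exact h4 h0

/-- The edge `i + h` opposite to a run is itself longer. It cannot be the first of its run: its
increments at `i` and `i + 1` already total 2, while such a run would need a further one at `i + n -
1`. -/
theorem run_start_shift (D : CyclicBiresidue n b c M) {h : ℕ} (hh : n = 2 * h + 1) (hn : 5 ≤ n)
    (hmin : ∀ j, 1 ≤ c j) {i : ℤ} (hi : c i = 1 ∧ c (i + 1) ≠ 1) :
    c (i + h - 2) = 1 ∧ c (i + h - 2 + 1) ≠ 1 := by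
  rcases (D.run_of_edge_lt hh hn hmin hi.1 hi.2).opposite with h2 | ⟨h1, h2, h3⟩
  · subst h2; simpa using hi
  rcases D.exists_run_start hh hn hmin hi.1 (j := i + h) (by rw [h1]; norm_num) with hm | hm
  · exfalso
    have hr := (D.run_of_edge_lt hh hn hmin hm.1 hm.2).incr_one
    rw [sub_add_cancel] at hr
    have k1 := hr.1
    have k2 := D.incr_add_add_le (i := i + h) (x := i + n) (y := i + 1 + n)
      (z := i + h - 1 + h + 1) ⟨by omega, by omega⟩ ⟨by omega, by omega⟩ ⟨by omega, by omega⟩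
      (by omega) (by omega) (by omega)
    rw [D.incr_periodic_right, D.incr_periodic_right] at k2
    omega
  · exact hm

theorem run_start_mul_five (D : CyclicBiresidue n b c M) {h : ℕ} (hh : n = 2 * h + 1)
    (hn : 5 ≤ n) (hmin : ∀ j, 1 ≤ c j) {i : ℤ} (hi : c i = 1 ∧ c (i + 1) ≠ 1) (t : ℤ) :
    c (i + 5 * t) = 1 ∧ c (i + 5 * t + 1) ≠ 1 := by
  have per : ∀ (j s : ℤ), c (j + s * n + 1) = c (j + 1) := by
    intro j s; rw [add_right_comm, D.edge_periodic_mul]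
  have key : ∀ k : ℕ, c (i - 5 * k) = 1 ∧ c (i - 5 * k + 1) ≠ 1 := by
    intro k
    induction k with
    | zero => simpa using hi
    | succ k ih =>
      have h1 := D.run_start_shift hh hn hmin (D.run_start_shift hh hn hmin ih)
      -- Two shifts by `h - 2` amount to `2 * h - 4 = n - 5`.
      rw [show i - 5 * (k : ℤ) + h - 2 + h - 2 = i - 5 * ((k + 1 : ℕ) : ℤ) + 1 * n by
        rw [hh]; push_cast; ring, per, D.edge_periodic_mul] at h1
      exact h1
  have h3 : 0 ≤ -t + |t| * n := by
    have := le_abs_self t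
    have := abs_nonneg t
    have : (5 : ℤ) ≤ n := by exact_mod_cast hn
    nlinarith
  have h4 := key (-t + |t| * n).toNat
  rwa [Int.toNat_of_nonneg h3,
    show i - 5 * (-t + |t| * n) = i + 5 * t + (-5 * |t|) * n by ring, per,
    D.edge_periodic_mul] at h4

/-! ### A kernel vector modulo 5 excludes longer edges -/

theorem incr_sum_mul (D : CyclicBiresidue n b c M) {i x y : ℤ} (hx : i + 1 < x ∧ x < i + n)
    (hy : i + 1 < y ∧ y < i + n) (hxy : x ≠ y) (hMx : M i x = 1) (hMy : M i y = 1)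
    (v : ℤ → ℝ) :
    ∑ d ∈ range n, (M i (i + d) : ℝ) * v (i + d) = v x + v y - v i - v (i + 1) := by
  have h0 : ∀ d ∈ range n, (M i (i + d) : ℝ) * v (i + d) =
      (if d = (x - i).toNat then v x else 0) + (if d = (y - i).toNat then v y else 0) -
      (if d = 0 then v i else 0) - (if d = 1 then v (i + 1) else 0) := by
    intro d hd
    rw [mem_range] at hd
    by_cases d0 : d = 0
    · subst d0
      rw [if_neg (by omega), if_neg (by omega), if_pos rfl, if_neg (by omega), Nat.cast_zero,
        add_zero, D.incr_self]
      push_cast; ring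
    by_cases d1 : d = 1
    · subst d1
      rw [if_neg (by omega), if_neg (by omega), if_neg (by omega), if_pos rfl, Nat.cast_one,
        D.incr_succ]
      push_cast; ring
    rw [if_neg d0, if_neg d1]
    by_cases dx : i + (d : ℤ) = x
    · rw [if_pos (by omega), if_neg (by omega), dx, hMx]; push_cast; ring
    by_cases dy : i + (d : ℤ) = y
    · rw [if_neg (by omega), if_pos (by omega), dy, hMy]; push_cast; ring
    have k1 := D.incr_add_add_le (z := i + d) hx hy ⟨by omega, by omega⟩ hxy (Ne.symm dx)
      (Ne.symm dy)
    have k2 := D.incr_nonneg i (i + d) (by omega) (by omega)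
    rw [if_neg (by omega), if_neg (by omega), show M i (i + d) = 0 by omega]
    push_cast; ring
  rw [sum_congr rfl h0]
  simp only [sum_sub_distrib, sum_add_distrib, Finset.sum_ite_eq', mem_range]
  rw [if_pos (by omega), if_pos (by omega), if_pos (by omega), if_pos (by omega)]

theorem mul_sum_succ (D : CyclicBiresidue n b c M) (i : ℤ) {v : ℤ → ℝ}
    (hv : ∀ j, v (j + n) = v j) :
    ∑ d ∈ range n, b (i + 1) (i + 1 + d) * v (i + 1 + d) =
      ∑ d ∈ range n, b i (i + d) * v (i + d) +
        c i * ∑ d ∈ range n, (M i (i + d) : ℝ) * v (i + d) := by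
  rw [sum_range_periodic (f := fun j => b (i + 1) j * v j)
    (fun j => by rw [D.periodic_right, hv]) (i + 1) i, mul_sum, ← sum_add_distrib]
  refine sum_congr rfl fun d _ => ?_
  rw [D.step]; ring

/-- Run starts recur every five positions. If 5 is invertible modulo `n`, the next edge is itself a
run start, hence a unit; otherwise a vector of period 5 violates `KernelConstant`. -/
theorem edge_eq_one (D : CyclicBiresidue n b c M) (hodd : Odd n) (hK : KernelConstant n b)
    (hmin : ∀ j, 1 ≤ c j) {i₀ : ℤ} (h0 : c i₀ = 1) (i : ℤ) : c i = 1 := by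
  have hn3 := D.three_le
  obtain ⟨h, hh⟩ := hodd
  by_cases hn : n = 3
  · rw [← h0]
    exact D.edge_const_of_succ (fun i hi => by rw [D.edge_eq_of_three hn, hi]) i
  have hn : 5 ≤ n := by omega
  rw [← h0]
  refine D.edge_const_of_succ (fun i hi => ?_) i
  rw [h0] at hi ⊢
  by_contra hi'
  have star := D.run_start_mul_five hh hn hmin ⟨hi, hi'⟩
  have h5 : 5 ∣ n := by
    by_contra h5
    have hcop : IsCoprime (5 : ℤ) n := by
      rw [show (5 : ℤ) = ((5 : ℕ) : ℤ) by rfl, Nat.isCoprime_iff_coprime]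
      exact (Nat.Prime.coprime_iff_not_dvd (by norm_num)).2 h5
    obtain ⟨u, w, huw⟩ := hcop
    have h6 := (star u).1
    rw [show i + 5 * u = i + 1 + (-w) * n by linear_combination huw, D.edge_periodic_mul] at h6
    exact hi' h6
  -- The pattern 0, 1, 0, 1, 0 over a period. It is orthogonal to the increment rows of the edges
  -- `I` to `I + 3` of each run, so one row orthogonal to it gives all five.
  let v : ℤ → ℝ := fun j => if (j - i) % 5 = 1 ∨ (j - i) % 5 = 3 then 1 else 0
  have v1 : ∀ j, ((j - i) % 5 = 1 ∨ (j - i) % 5 = 3) → v j = 1 := fun j hj => if_pos hj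
  have v0 : ∀ j, ¬((j - i) % 5 = 1 ∨ (j - i) % 5 = 3) → v j = 0 := fun j hj => if_neg hj
  have vper : ∀ m : ℕ, 5 ∣ m → ∀ j, v (j + m) = v j := by
    intro m hm j
    by_cases hj : (j - i) % 5 = 1 ∨ (j - i) % 5 = 3
    · rw [v1 j hj, v1 _ (by omega)]
    · rw [v0 j hj, v0 _ (by omega)]
  have hvn := vper n h5
  have hrows : ∀ j, ∑ d ∈ range n, b j (j + d) * v (j + d) = 0 := by
    intro j
    have hI := star ((j - i) / 5)
    have hmod := Int.mul_ediv_add_emod (j - i) 5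
    have hlt := Int.emod_lt_of_pos (j - i) (show (0 : ℤ) < 5 by norm_num)
    have hge := Int.emod_nonneg (j - i) (show (5 : ℤ) ≠ 0 by norm_num)
    generalize hIdef : i + 5 * ((j - i) / 5) = I at hI
    have hI5 : (I - i) % 5 = 0 := by omega
    have run := D.run_of_edge_lt hh hn hmin hI.1 hI.2
    have r0 : ∑ d ∈ range n, b I (I + d) * v (I + d) = 0 := by
      rw [← Finset.sum_range_add_sum_Ico _ (show h + 1 ≤ n by omega), Finset.sum_range_succ',
        Finset.sum_Ico_eq_sum_range, show n - (h + 1) = h by omega]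
      have s1 : ∑ k ∈ range h, b I (I + (k + 1 : ℕ)) * v (I + (k + 1 : ℕ)) =
          ∑ k ∈ range h, v (I + 1 + k) := by
        refine sum_congr rfl fun k hk => ?_
        rw [mem_range] at hk
        rw [run.row_pos _ (by omega) (by omega), one_mul]
        congr 1; push_cast; ring
      have s2 : ∑ k ∈ range h, b I (I + (h + 1 + k : ℕ)) * v (I + (h + 1 + k : ℕ)) =
          -∑ k ∈ range h, v (I + h + 1 + k) := by
        rw [← sum_neg_distrib]
        refine sum_congr rfl fun k hk => ?_
        rw [mem_range] at hk
        rw [run.row_neg _ (by omega) (by omega), neg_one_mul]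
        congr 2; push_cast; ring
      rw [s1, s2, Nat.cast_zero, add_zero, D.diag]
      -- Since 5 divides `2 * h + 1`, `h` is 2 modulo 5. Both half-rows contain `h - 2` terms
      -- forming full periods, and the two leftover terms are 1 and 0 in each.
      have hh2 : h = h - 2 + 1 + 1 := by omega
      have hsplit : ∀ x : ℤ, ∑ k ∈ range h, v (x + k) =
          ∑ k ∈ range (h - 2), v (x + k) + v (x + (h - 2 : ℕ)) + v (x + (h - 2 + 1 : ℕ)) := by
        intro x
        conv_lhs => rw [hh2]
        rw [sum_range_succ, sum_range_succ]
      rw [hsplit, hsplit, sum_range_periodic (vper (h - 2) (by omega)) (I + h + 1) (I + 1),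
        v1 (I + 1 + (h - 2 : ℕ)) (by omega), v0 (I + 1 + (h - 2 + 1 : ℕ)) (by omega),
        v1 (I + h + 1 + (h - 2 : ℕ)) (by omega), v0 (I + h + 1 + (h - 2 + 1 : ℕ)) (by omega)]
      ring
    have q0 := D.incr_sum_mul (i := I) (x := I + 2) (y := I + 3) ⟨by omega, by omega⟩
      ⟨by omega, by omega⟩ (by omega) run.incr_zero.1 run.incr_zero.2 v
    have q1 := D.incr_sum_mul (i := I + 1) (x := I + h + 1) (y := I + h + 2)
      ⟨by omega, by omega⟩ ⟨by omega, by omega⟩ (by omega) run.incr_one.1 run.incr_one.2 v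
    have q2 := D.incr_sum_mul (i := I + 2) (x := I + h + 3) (y := I + h + 4)
      ⟨by omega, by omega⟩ ⟨by omega, by omega⟩ (by omega) run.incr_two.1 run.incr_two.2 v
    have q3 := D.incr_sum_mul (i := I + 3) (x := I + 1 + n) (y := I + 2 + n)
      ⟨by omega, by omega⟩ ⟨by omega, by omega⟩ (by omega)
      (by rw [D.incr_periodic_right, run.incr_three.1])
      (by rw [D.incr_periodic_right, run.incr_three.2]) v
    rw [v0 (I + 2) (by omega), v1 (I + 3) (by omega), v0 I (by omega),
      v1 (I + 1) (by omega)] at q0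
    rw [v1 (I + h + 1) (by omega), v0 (I + h + 2) (by omega), v1 (I + 1) (by omega),
      v0 (I + 1 + 1) (by omega)] at q1
    rw [v0 (I + h + 3) (by omega), v1 (I + h + 4) (by omega), v0 (I + 2) (by omega),
      v1 (I + 2 + 1) (by omega)] at q2
    rw [v1 (I + 1 + n) (by omega), v0 (I + 2 + n) (by omega), v1 (I + 3) (by omega),
      v0 (I + 3 + 1) (by omega)] at q3
    have r1 := D.mul_sum_succ I hvn
    rw [q0, r0] at r1
    have r2 := D.mul_sum_succ (I + 1) hvn
    rw [q1, r1, show I + 1 + 1 = I + 2 by ring] at r2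
    have r3 := D.mul_sum_succ (I + 2) hvn
    rw [q2, r2, show I + 2 + 1 = I + 3 by ring] at r3
    have r4 := D.mul_sum_succ (I + 3) hvn
    rw [q3, r3, show I + 3 + 1 = I + 4 by ring] at r4
    have hj : j = I ∨ j = I + 1 ∨ j = I + 2 ∨ j = I + 3 ∨ j = I + 4 := by omega
    rcases hj with rfl | rfl | rfl | rfl | rfl
    · exact r0
    · rw [r1]; norm_num
    · rw [r2]; norm_num
    · rw [r3]; norm_num
    · rw [r4]; norm_num
  have := hK v hvn hrows i (i + 1)
  rw [v0 i (by omega), v1 (i + 1) (by omega)] at this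
  norm_num at this

/-! ### Unit edges: block rows and their widths -/

/-- The row starts at 1 and drops by integers, and the neighbouring unit edges confine it to the
interval from -1 to 1. -/
theorem entry_trichotomy (D : CyclicBiresidue n b c M) (hc : ∀ i, c i = 1) {i j : ℤ} (h1 : i < j)
    (h2 : j < i + n) : b i j = 1 ∨ b i j = 0 ∨ b i j = -1 := by
  have hz : ∀ j, i + 1 ≤ j → ∃ z : ℤ, b i j = z := by
    intro j hj
    induction j, hj using Int.leInduction with
    | base => exact ⟨1, by rw [D.edge, hc]; norm_num⟩
    | succ j hj ih =>
      obtain ⟨z, hz⟩ := ih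
      exact ⟨z - M j i, by rw [D.drop, hz, hc]; push_cast; ring⟩
  obtain ⟨z, hz⟩ := hz j (by omega)
  have h3 := D.le_edge h1 h2
  have h4 := D.neg_edge_le (i := i - 1) (j := j) (by omega) (by omega)
  rw [sub_add_cancel] at h4
  rw [hc, hz] at h3 h4
  have h5 : z ≤ 1 := by exact_mod_cast h3
  have h6 : -1 ≤ z := by exact_mod_cast h4
  have h7 : z = 1 ∨ z = 0 ∨ z = -1 := by omega
  rw [hz]
  rcases h7 with rfl | rfl | rfl <;> simp

theorem exists_row_shape (D : CyclicBiresidue n b c M) (hc : ∀ i, c i = 1) (i : ℤ) :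
    ∃ a : ℕ, 1 ≤ a ∧ 2 * a < n ∧ (∀ j, i < j → j ≤ i + a → b i j = 1) ∧
      (∀ j, i + a < j → j < i + n - a → b i j = 0) ∧
      ∀ j, i + n - a ≤ j → j < i + n → b i j = -1 := by
  classical
  have hn := D.three_le
  let P : ℕ → Prop := fun d => b i (i + d) = 1
  let Q : ℕ → Prop := fun d => b i (i + n - d) = -1
  have hP1 : P 1 := by change b i (i + (1 : ℕ)) = 1; rw [Nat.cast_one, D.edge, hc]
  have hQ1 : Q 1 := by
    change b i (i + n - (1 : ℕ)) = -1
    rw [Nat.cast_one, show i + n - 1 = i - 1 + n by ring, D.periodic_right]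
    have := D.edge_back (i - 1)
    rwa [sub_add_cancel, hc] at this
  obtain ⟨a, ha⟩ : ∃ a, a = Nat.findGreatest P (n - 1) := ⟨_, rfl⟩
  obtain ⟨e, he⟩ : ∃ e, e = Nat.findGreatest Q (n - 1) := ⟨_, rfl⟩
  have hPa : P a := ha ▸ Nat.findGreatest_spec (P := P) (by omega : 1 ≤ n - 1) hP1
  have hQe : Q e := he ▸ Nat.findGreatest_spec (P := Q) (by omega : 1 ≤ n - 1) hQ1
  have ha1 : 1 ≤ a := ha ▸ Nat.le_findGreatest (P := P) (by omega) hP1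
  have he1 : 1 ≤ e := he ▸ Nat.le_findGreatest (P := Q) (by omega) hQ1
  have han : a ≤ n - 1 := ha ▸ Nat.findGreatest_le _
  have hen : e ≤ n - 1 := he ▸ Nat.findGreatest_le _
  have hPgt : ∀ d, a < d → d ≤ n - 1 → ¬P d := fun d h1 h2 =>
    Nat.findGreatest_is_greatest (P := P) (ha ▸ h1) h2
  have hQgt : ∀ d, e < d → d ≤ n - 1 → ¬Q d := fun d h1 h2 =>
    Nat.findGreatest_is_greatest (P := Q) (he ▸ h1) h2
  change b i (i + a) = 1 at hPa
  change b i (i + n - e) = -1 at hQe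
  have pos : ∀ j, i < j → j ≤ i + a → b i j = 1 := by
    intro j h1 h2
    have h3 := D.antitone h1 h2 (by omega)
    rcases D.entry_trichotomy hc h1 (by omega) with h4 | h4 | h4 <;> linarith
  have neg : ∀ j, i + n - e ≤ j → j < i + n → b i j = -1 := by
    intro j h1 h2
    have h3 := D.antitone (i := i) (j := i + n - e) (k := j) (by omega) h1 h2
    rcases D.entry_trichotomy hc (i := i) (j := j) (by omega) (by omega) with h4 | h4 | h4 <;>
      linarith
  have zero : ∀ j, i + a < j → j < i + n - e → b i j = 0 := by
    intro j h1 h2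
    rcases D.entry_trichotomy hc (i := i) (j := j) (by omega) (by omega) with h4 | h4 | h4
    · refine absurd ?_ (hPgt (j - i).toNat (by omega) (by omega))
      change b i (i + (j - i).toNat) = 1
      rwa [Int.toNat_of_nonneg (by omega), add_sub_cancel]
    · exact h4
    · refine absurd ?_ (hQgt (i + n - j).toNat (by omega) (by omega))
      change b i (i + n - (i + n - j).toNat) = -1
      rwa [Int.toNat_of_nonneg (by omega), sub_sub_cancel]
  have hae : a + e < n := by
    by_contra hcon
    have h1 := pos (i + a) (by omega) (by omega)
    have h2 := neg (i + a) (by omega) (by omega)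
    rw [h1] at h2; norm_num at h2
  have hsum := D.row_sum_split i (m := a + 1) (by omega) (by omega)
  rw [← Finset.sum_Ico_consecutive _ (show a + 1 ≤ n - e by omega) (show n - e ≤ n by omega)]
    at hsum
  have s1 : ∑ d ∈ Ico 1 (a + 1), b i (i + d) = a := by
    rw [sum_congr rfl (g := fun _ => (1 : ℝ)) fun d hd => by
      rw [mem_Ico] at hd; exact pos _ (by omega) (by omega)]
    simp
  have s2 : ∑ d ∈ Ico (a + 1) (n - e), b i (i + d) = 0 :=
    sum_eq_zero fun d hd => by rw [mem_Ico] at hd; exact zero _ (by omega) (by omega)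
  have s3 : ∑ d ∈ Ico (n - e) n, b i (i + d) = -e := by
    rw [sum_congr rfl (g := fun _ => (-1 : ℝ)) fun d hd => by
      rw [mem_Ico] at hd; exact neg _ (by omega) (by omega)]
    rw [sum_const, Nat.card_Ico, show n - (n - e) = e by omega]
    simp
  rw [s1, s2, s3] at hsum
  have hea : e = a := by
    have : (e : ℝ) = a := by linarith
    exact_mod_cast this
  subst hea
  exact ⟨e, ha1, by omega, pos, zero, neg⟩

/-- The indicator of the multiples of `g` lies in the kernel, so it is constant and `g = 1`. On each
row it compares two windows of length `a i`. They agree if `g` divides the length; if `g` divides `a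
i + 1`, extend them by `i` and `i + n`, where the indicator has the same value. -/
theorem kernel_of_dvd (D : CyclicBiresidue n b c M) {a : ℤ → ℕ} (han : ∀ i, 2 * a i < n)
    (pos : ∀ i j, i < j → j ≤ i + a i → b i j = 1)
    (zero : ∀ i j, i + a i < j → j < i + n - a i → b i j = 0)
    (neg : ∀ i j, i + n - a i ≤ j → j < i + n → b i j = -1)
    (hK : KernelConstant n b) {g : ℕ} (hgn : g ∣ n) (hga : ∀ i, g ∣ a i ∨ g ∣ a i + 1) :
    g = 1 := by
  classical
  let v : ℤ → ℝ := fun j => if (g : ℤ) ∣ j then 1 else 0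
  have vper : ∀ m : ℕ, g ∣ m → ∀ j, v (j + m) = v j := by
    intro m hm j
    have : ((g : ℤ) ∣ j + m) ↔ (g : ℤ) ∣ j := dvd_add_left (Int.natCast_dvd_natCast.2 hm)
    simp only [v, this]
  have hrows : ∀ i, ∑ d ∈ range n, b i (i + d) * v (i + d) = 0 := by
    intro i
    have hi := han i
    have h1 : ∑ d ∈ range n, b i (i + d) * v (i + d) =
        ∑ k ∈ range (a i), v (i + 1 + k) - ∑ k ∈ range (a i), v (i + n - a i + k) := by
      rw [← Finset.sum_range_add_sum_Ico _ (show a i + 1 ≤ n by omega),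
        ← Finset.sum_Ico_consecutive _ (show a i + 1 ≤ n - a i by omega)
          (show n - a i ≤ n by omega), Finset.sum_range_succ',
        Finset.sum_Ico_eq_sum_range _ (n - a i) n, show n - (n - a i) = a i by omega]
      have s1 : ∑ k ∈ range (a i), b i (i + (k + 1 : ℕ)) * v (i + (k + 1 : ℕ)) =
          ∑ k ∈ range (a i), v (i + 1 + k) := by
        refine sum_congr rfl fun k hk => ?_
        rw [mem_range] at hk
        rw [pos _ _ (by omega) (by omega), one_mul]
        congr 1; push_cast; ring
      have s2 : ∑ d ∈ Ico (a i + 1) (n - a i), b i (i + d) * v (i + d) = 0 :=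
        sum_eq_zero fun d hd => by
          rw [mem_Ico] at hd; rw [zero _ _ (by omega) (by omega), zero_mul]
      have s3 : ∑ k ∈ range (a i), b i (i + (n - a i + k : ℕ)) * v (i + (n - a i + k : ℕ)) =
          -∑ k ∈ range (a i), v (i + n - a i + k) := by
        rw [← sum_neg_distrib]
        refine sum_congr rfl fun k hk => ?_
        rw [mem_range] at hk
        rw [neg _ _ (by omega) (by omega), neg_one_mul]
        congr 2; omega
      rw [s1, s2, s3, Nat.cast_zero, add_zero, D.diag]
      ring
    rw [h1]
    rcases hga i with h2 | h2
    · rw [sum_range_periodic (vper _ h2) (i + 1) (i + n - a i), sub_self]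
    · have h3 := sum_range_periodic (vper _ h2) i (i + n - a i)
      rw [sum_range_succ', sum_range_succ, Nat.cast_zero, add_zero, sub_add_cancel,
        vper n hgn] at h3
      rw [← add_right_cancel h3, sub_eq_zero]
      refine sum_congr rfl fun k _ => ?_
      congr 1; push_cast; ring
  have h01 := hK v (vper n hgn) hrows 0 1
  simp only [v, dvd_zero, if_true] at h01
  split_ifs at h01 with h
  · exact_mod_cast Int.eq_one_of_dvd_one (by positivity) h
  · norm_num at h01

/-- Unit edges force the circulant shape. -/
theorem circulant_of_edge_eq_one (D : CyclicBiresidue n b c M) (hK : KernelConstant n b)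
    (hc : ∀ i, c i = 1) :
    ∃ k : ℕ, 1 ≤ k ∧ 2 * k < n ∧ Nat.gcd n k = 1 ∧ Nat.gcd n (k + 1) = 1 ∧
      (∀ i j : ℤ, i < j → j ≤ i + k → b i j = 1) ∧
      (∀ i j : ℤ, i + k < j → j < i + n - k → b i j = 0) ∧
      ∀ i j : ℤ, i + n - k ≤ j → j < i + n → b i j = -1 := by
  choose a ha1 han pos zero neg using D.exists_row_shape hc
  have one_iff : ∀ i (d : ℕ), 1 ≤ d → d < n → (b i (i + d) = 1 ↔ d ≤ a i) := by
    intro i d h1 h2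
    refine ⟨fun h => ?_, fun h => pos i _ (by omega) (by omega)⟩
    by_contra hcon
    rcases lt_or_ge (i + d : ℤ) (i + n - a i) with h3 | h3
    · rw [zero i _ (by omega) h3] at h; norm_num at h
    · rw [neg i _ h3 (by omega)] at h; norm_num at h
  have neg_iff : ∀ i (d : ℕ), 1 ≤ d → d < n → (b i (i + n - d) = -1 ↔ d ≤ a i) := by
    intro i d h1 h2
    refine ⟨fun h => ?_, fun h => neg i _ (by omega) (by omega)⟩
    by_contra hcon
    rcases le_or_gt (i + n - d : ℤ) (i + a i) with h3 | h3
    · rw [pos i _ (by omega) h3] at h; norm_num at h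
    · rw [zero i _ (by omega) (by omega)] at h; norm_num at h
  -- The entry of row `i` at distance `d` is minus the entry of row `i + d` at distance `-d`.
  have shift : ∀ i (d : ℕ), d < n → (d ≤ a i ↔ d ≤ a (i + d)) := by
    intro i d h2
    rcases Nat.eq_zero_or_pos d with rfl | h1
    · simp
    rw [← one_iff i d h1 h2, ← neg_iff (i + d) d h1 h2, add_right_comm, add_sub_cancel_right,
      D.periodic_right, D.skew (i + d) i, neg_inj]
  have shift_mul : ∀ (d : ℕ), d < n → ∀ (t i : ℤ), (d ≤ a i ↔ d ≤ a (i + t * d)) := by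
    intro d hd t
    induction t using Int.induction_on with
    | zero => intro i; simp
    | succ t ih =>
      intro i
      rw [ih i, shift _ d hd, add_mul, one_mul, add_assoc]
    | pred t ih =>
      intro i
      rw [ih i, shift (i + (-(t : ℤ) - 1) * d) d hd]
      rw [show i + (-(t : ℤ) - 1) * d + d = i + -(t : ℤ) * d by ring]
  have aper : ∀ i, a (i + n) = a i := by
    have h : ∀ i (d : ℕ), 1 ≤ d → d < n → (d ≤ a (i + n) ↔ d ≤ a i) := by
      intro i d h1 h2
      rw [← one_iff i d h1 h2, ← one_iff (i + n) d h1 h2, add_right_comm, D.periodic,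
        D.periodic_right]
    intro i
    refine le_antisymm ?_ ?_
    · exact (h i _ (ha1 _) (by have := han (i + n); omega)).1 le_rfl
    · exact (h i _ (ha1 _) (by have := han i; omega)).2 le_rfl
  have aper_mul : ∀ i t : ℤ, a (i + t * n) = a i := fun i t =>
    Function.Periodic.int_mul (f := a) (c := (n : ℤ)) aper t i
  have hmax : ∃ i₀, ∀ i, a i ≤ a i₀ := by
    refine ⟨Function.argmin (fun i : ℤ => n - a i), fun i => ?_⟩
    have h1 := Function.argmin_le (fun i : ℤ => n - a i) i
    have h2 := han i
    have h3 := han (Function.argmin (fun i : ℤ => n - a i))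
    omega
  obtain ⟨i₀, hmax⟩ := hmax
  obtain ⟨k, hk⟩ : ∃ k, k = a i₀ := ⟨_, rfl⟩
  have hkn : 2 * k < n := hk ▸ han i₀
  have hk1 : 1 ≤ k := hk ▸ ha1 i₀
  have kernel := fun {g : ℕ} => D.kernel_of_dvd han pos zero neg hK (g := g)
  -- Steps of `k` from the widest row `i₀` and steps of `k - 1` from `i` meet: `i + (i - i₀) * (k -
  -- 1) = i₀ + (i - i₀) * k`. So all the widths are `k` or `k - 1`.
  have hpred : ∀ i, k - 1 ≤ a i := by
    intro i
    have h1 := (shift_mul k (by omega) (i - i₀) i₀).1 hk.le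
    rw [shift_mul (k - 1) (by omega) (i - i₀) i]
    have h2 : i + (i - i₀) * ((k - 1 : ℕ) : ℤ) = i₀ + (i - i₀) * k := by
      rw [Nat.cast_sub hk1]; push_cast; ring
    rw [h2]; omega
  have hg : Nat.gcd n k = 1 := by
    refine kernel (Nat.gcd_dvd_left n k) fun i => ?_
    have h1 := hpred i
    have h2 := hmax i
    have h3 : a i = k ∨ a i + 1 = k := by omega
    rcases h3 with h3 | h3
    · left; rw [h3]; exact Nat.gcd_dvd_right n k
    · right; rw [h3]; exact Nat.gcd_dvd_right n k
  -- As `k` is invertible modulo `n`, steps of `k` from `i₀` reach every row.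
  have hconst : ∀ i, a i = k := by
    intro i
    refine le_antisymm (hk ▸ hmax i) ?_
    obtain ⟨u, w, huw⟩ := Nat.isCoprime_iff_coprime.2 hg
    have h1 := (shift_mul k (by omega) ((i - i₀) * w) i₀).1 hk.le
    rwa [← aper_mul _ ((i - i₀) * u), show i₀ + (i - i₀) * w * k + (i - i₀) * u * n = i by
      linear_combination (i - i₀) * huw] at h1
  have hg' : Nat.gcd n (k + 1) = 1 := by
    refine kernel (Nat.gcd_dvd_left n (k + 1)) fun i => ?_
    right; rw [hconst]; exact Nat.gcd_dvd_right n (k + 1)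
  refine ⟨k, hk1, hkn, hg, hg', ?_, ?_, ?_⟩
  · intro i; have := pos i; rwa [hconst] at this
  · intro i; have := zero i; rwa [hconst] at this
  · intro i; have := neg i; rwa [hconst] at this

theorem scale (D : CyclicBiresidue n b c M) {r : ℝ} (hr : 0 < r) :
    CyclicBiresidue n (fun i j => r * b i j) (fun i => r * c i) M where
  three_le := D.three_le
  skew i j := by rw [D.skew]; ring
  periodic i j := by rw [D.periodic]
  pos i := mul_pos hr (D.pos i)
  step i j := by rw [D.step]; ring
  incr_self := D.incr_self
  incr_succ := D.incr_succ
  incr_nonneg := D.incr_nonneg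
  row_sum i := by rw [← mul_sum, D.row_sum, mul_zero]

theorem exists_edge_min (D : CyclicBiresidue n b c M) : ∃ i₀, ∀ i, c i₀ ≤ c i := by
  have hn := D.three_le
  obtain ⟨i₀, -, h0⟩ := Finset.exists_min_image (Finset.Ico (0 : ℤ) n) c
    ⟨0, by rw [Finset.mem_Ico]; omega⟩
  refine ⟨i₀, fun i => ?_⟩
  have h1 := h0 (i % n) (by
    rw [Finset.mem_Ico]
    exact ⟨Int.emod_nonneg _ (by omega), Int.emod_lt_of_pos _ (by omega)⟩)
  have h2 := D.edge_periodic_mul (i % n) (i / n)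
  rw [mul_comm, Int.emod_add_mul_ediv] at h2
  rwa [h2]

/-- If the kernel is spanned by the constant vectors and `n` is odd, then the matrix is a
multiple of one of the circulant matrices. -/
theorem circulant (D : CyclicBiresidue n b c M) (hodd : Odd n) (hK : KernelConstant n b) :
    ∃ r : ℝ, 0 < r ∧ ∃ k : ℕ, 1 ≤ k ∧ 2 * k < n ∧ Nat.gcd n k = 1 ∧ Nat.gcd n (k + 1) = 1 ∧
      (∀ i j : ℤ, i < j → j ≤ i + k → r * b i j = 1) ∧
      (∀ i j : ℤ, i + k < j → j < i + n - k → r * b i j = 0) ∧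
      ∀ i j : ℤ, i + n - k ≤ j → j < i + n → r * b i j = -1 := by
  obtain ⟨i₀, hmin⟩ := D.exists_edge_min
  have hr : 0 < (c i₀)⁻¹ := inv_pos.2 (D.pos i₀)
  have D' := D.scale hr
  have hK' : KernelConstant n fun i j => (c i₀)⁻¹ * b i j := by
    intro v hv h
    refine hK v hv fun i => ?_
    have h1 := h i
    simp only [mul_assoc] at h1
    rw [← mul_sum] at h1
    exact (mul_eq_zero.1 h1).resolve_left hr.ne'
  refine ⟨_, hr, D'.circulant_of_edge_eq_one hK' (D'.edge_eq_one hodd hK' (fun j => ?_)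
    (i₀ := i₀) (inv_mul_cancel₀ (D.pos i₀).ne'))⟩
  rw [inv_mul_eq_div, one_le_div (D.pos i₀)]
  exact hmin j

end CyclicBiresidue

/-! ### Cycles, projective equivalence and the circulant matrices -/

theorem smoothableCycle_iff {n : ℕ} (hn : 3 ≤ n) (B : Matrix (Fin n) (Fin n) ℂ) :
    HasFullSmoothableCycle B ↔
      ∃ σ : Equiv.Perm (Fin n), ∀ i j : Fin n, (j - i).val = 1 →
        (smoothableGraph B).Adj (σ i) (σ j) := by
  have h1 : HasFullSmoothableCycle B ↔
      (SimpleGraph.cycleGraph n).IsContained (smoothableGraph B) := by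
    rw [SimpleGraph.cycleGraph_isContained_iff (by omega)]
    simp only [HasFullSmoothableCycle,
      SimpleGraph.Walk.isHamiltonianCycle_iff_isCycle_and_length_eq, Fintype.card_fin]
  rw [h1]
  constructor
  · rintro ⟨φ⟩
    refine ⟨Equiv.ofBijective φ (Finite.injective_iff_bijective.1 φ.injective), fun i j hij => ?_⟩
    exact φ.toHom.map_adj (SimpleGraph.cycleGraph_adj'.2 (Or.inr hij))
  · rintro ⟨σ, hσ⟩
    refine ⟨⟨⟨σ, fun {i j} hij => ?_⟩, σ.injective⟩⟩
    rcases SimpleGraph.cycleGraph_adj'.1 hij with h | h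
    · exact (hσ _ _ h).symm
    · exact hσ _ _ h

theorem projectivelyEquivalent_iff {n : ℕ} (B B' : Matrix (Fin n) (Fin n) ℂ) :
    ProjectivelyEquivalent B B' ↔
      ∃ (σ : Equiv.Perm (Fin n)) (c : ℂ), c ≠ 0 ∧ ∀ i j, B' i j = c * B (σ i) (σ j) := by
  have key : ∀ σ : Equiv.Perm (Fin n), (σ.permMatrix ℂ)⁻¹ * B * σ.permMatrix ℂ =
      B.submatrix (σ⁻¹ : Equiv.Perm (Fin n)) (σ⁻¹ : Equiv.Perm (Fin n)) := by
    intro σ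
    have h1 : (σ.permMatrix ℂ)⁻¹ = (σ⁻¹ : Equiv.Perm (Fin n)).permMatrix ℂ := by
      refine Matrix.inv_eq_left_inv ?_
      rw [← Matrix.permMatrix_mul, mul_inv_cancel, Matrix.permMatrix_one]
    rw [h1, PEquiv.toMatrix_toPEquiv_mul, PEquiv.mul_toMatrix_toPEquiv]
    rfl
  constructor
  · rintro ⟨σ, c, hc, rfl⟩
    exact ⟨σ⁻¹, c, hc, fun i j => by rw [key]; rfl⟩
  · rintro ⟨σ, c, hc, h⟩
    refine ⟨σ⁻¹, c, hc, ?_⟩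
    ext i j
    rw [key, inv_inv, h]; rfl

theorem Fin.val_sub_eq {n : ℕ} (i j : Fin n) :
    (j - i).val = if i.val ≤ j.val then j.val - i.val else n + j.val - i.val := by
  have hi := i.isLt
  have hj := j.isLt
  rw [Fin.sub_def]
  split_ifs with h
  · change (n - i.val + j.val) % n = _
    rw [show n - i.val + j.val = j.val - i.val + n by omega, Nat.add_mod_right,
      Nat.mod_eq_of_lt (by omega)]
  · change (n - i.val + j.val) % n = _
    rw [Nat.mod_eq_of_lt (by omega)]
    omega

theorem isSmoothable_cyclicMatrix {n k : ℕ} (hk : 1 ≤ k) (hkn : 2 * k < n) {i j : Fin n}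
    (hij : (j - i).val = 1) : IsSmoothable (cyclicMatrix n k) i j := by
  have hi := i.isLt
  have hj := j.isLt
  rw [Fin.val_sub_eq] at hij
  have h1 : cyclicMatrix n k i j = 1 := by
    simp only [cyclicMatrix, Matrix.of_apply, cyclicRow, Fin.val_sub_eq]
    split_ifs at hij ⊢ <;> first | rfl | omega
  refine ⟨by rw [h1]; exact one_ne_zero, fun x hxi hxj => ?_⟩
  have hx := x.isLt
  rw [Ne, Fin.ext_iff] at hxi hxj
  rw [h1, div_one]
  simp only [cyclicMatrix, Matrix.of_apply, cyclicRow, Fin.val_sub_eq]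
  split_ifs at hij ⊢ <;>
    first
    | omega
    | (refine ⟨0, ?_⟩; norm_num; done)
    | (refine ⟨1, ?_⟩; norm_num; done)
    | (refine ⟨2, ?_⟩; norm_num)

theorem IsSmoothable.of_smul {n : ℕ} {B B' : Matrix (Fin n) (Fin n) ℂ}
    {σ : Equiv.Perm (Fin n)} {c : ℂ} (hc : c ≠ 0) (h : ∀ i j, B' i j = c * B (σ i) (σ j))
    {i j : Fin n} (hs : IsSmoothable B' i j) : IsSmoothable B (σ i) (σ j) := by
  obtain ⟨h1, h2⟩ := hs
  rw [h] at h1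
  refine ⟨right_ne_zero_of_mul h1, fun x hxi hxj => ?_⟩
  obtain ⟨m, hm⟩ := h2 (σ.symm x) (by rintro rfl; simp at hxi) (by rintro rfl; simp at hxj)
  refine ⟨m, ?_⟩
  rw [h, h, h, Equiv.apply_symm_apply, ← mul_add, mul_div_mul_left _ _ hc] at hm
  exact hm

theorem hasFullSmoothableCycle_of_cyclicMatrix {n k : ℕ} {B : Matrix (Fin n) (Fin n) ℂ}
    (hB : IsBiresidueMatrix B) (hk : 1 ≤ k) (hkn : 2 * k < n)
    (h : ProjectivelyEquivalent B (cyclicMatrix n k)) : HasFullSmoothableCycle B := by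
  obtain ⟨σ, c, hc, h⟩ := (projectivelyEquivalent_iff _ _).1 h
  refine (smoothableCycle_iff (by omega) B).2 ⟨σ, fun i j hij => ?_⟩
  refine (smoothableGraph_adj hB _ _).2
    ⟨fun he => ?_, (isSmoothable_cyclicMatrix hk hkn hij).of_smul hc h⟩
  rw [σ.injective he, Fin.val_sub_eq] at hij
  simp at hij

/-! ### Consequences of the rank condition -/

theorem mulVec_eq_zero_const {n : ℕ} {B : Matrix (Fin n) (Fin n) ℂ}
    (hsum : ∀ i, ∑ j, B i j = 0) (hrank : B.rank + 1 = n) {w : Fin n → ℂ}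
    (hw : B.mulVec w = 0) (x y : Fin n) : w x = w y := by
  have h1 := LinearMap.finrank_range_add_finrank_ker B.mulVecLin
  have h2 : Module.finrank ℂ (LinearMap.ker B.mulVecLin) = 1 := by
    rw [Module.finrank_fin_fun] at h1
    have : B.rank = Module.finrank ℂ (LinearMap.range B.mulVecLin) := rfl
    omega
  have hone : (fun _ => 1 : Fin n → ℂ) ∈ LinearMap.ker B.mulVecLin := by
    rw [LinearMap.mem_ker, Matrix.mulVecLin_apply]
    ext i
    simp [Matrix.mulVec, dotProduct, hsum i]
  have hne : (⟨_, hone⟩ : LinearMap.ker B.mulVecLin) ≠ 0 := by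
    intro h
    have := congrFun (congrArg Subtype.val h) x
    simp at this
  obtain ⟨r, hr⟩ := (finrank_eq_one_iff_of_nonzero' _ hne).1 h2
    ⟨w, by rw [LinearMap.mem_ker, Matrix.mulVecLin_apply, hw]⟩
  have hr' : ∀ z, r = w z := fun z => by
    have := congrFun (congrArg Subtype.val hr) z
    simpa using this
  rw [← hr', ← hr']

/-- For even `n`, deleting the last row and column leaves a skew-symmetric matrix of odd size, which
is singular. A kernel vector extended by 0 is killed by `B`, the last coordinate because the columns
sum to zero; being constant, it vanishes. -/
theorem odd_of_rank {n : ℕ} {B : Matrix (Fin n) (Fin n) ℂ} (hB : IsBiresidueMatrix B)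
    (hsum : ∀ i, ∑ j, B i j = 0) (hrank : B.rank + 1 = n) : Odd n := by
  by_contra hodd
  obtain ⟨m, rfl⟩ : ∃ m, n = m + 1 := ⟨B.rank, hrank.symm⟩
  have hm : Odd m := by
    rw [Nat.not_odd_iff_even, Nat.even_add_one, Nat.not_even_iff_odd] at hodd
    exact hodd
  let A := B.submatrix (Fin.castSucc : Fin m → Fin (m + 1)) Fin.castSucc
  have hA : A.transpose = -A := by
    ext i j
    exact hB.apply_swap _ _
  have hdet : A.det = 0 := by
    have h1 := Matrix.det_transpose A
    rw [hA, Matrix.det_neg, Fintype.card_fin, hm.neg_one_pow] at h1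
    linear_combination (-1 / 2 : ℂ) * h1
  obtain ⟨w, hw0, hw⟩ := Matrix.exists_mulVec_eq_zero_iff.2 hdet
  let u : Fin (m + 1) → ℂ := Fin.snoc w 0
  have hucast : ∀ j : Fin m, B.mulVec u j.castSucc = 0 := by
    intro j
    have := congrFun hw j
    rw [Matrix.mulVec, dotProduct, Fin.sum_univ_castSucc]
    simpa [u, A, Matrix.mulVec, dotProduct] using this
  have hcol : ∑ i, B.mulVec u i = 0 := by
    simp only [Matrix.mulVec, dotProduct]
    rw [Finset.sum_comm]
    refine sum_eq_zero fun j _ => ?_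
    rw [← sum_mul]
    have : ∑ i, B i j = -∑ i, B j i := by
      rw [← sum_neg_distrib]
      exact sum_congr rfl fun i _ => hB.apply_swap _ _
    rw [this, hsum, neg_zero, zero_mul]
  have hu : B.mulVec u = 0 := by
    rw [Fin.sum_univ_castSucc, sum_eq_zero fun j _ => hucast j, zero_add] at hcol
    ext i
    refine Fin.lastCases ?_ (fun j => ?_) i
    · exact hcol
    · exact hucast j
  refine hw0 (funext fun j => ?_)
  have := mulVec_eq_zero_const hsum hrank hu j.castSucc (Fin.last m)
  simpa [u] using this

/-! ### From the complex matrix to real cyclic data -/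

/-- The vertex in the position `i` modulo `n`. -/
def Fin.ofIntMod {n : ℕ} (hn : 0 < n) (i : ℤ) : Fin n :=
  ⟨(i % n).toNat, by
    have := Int.emod_nonneg i (show (n : ℤ) ≠ 0 by omega)
    have := Int.emod_lt_of_pos i (show (0 : ℤ) < n by omega)
    omega⟩

theorem Fin.val_ofIntMod {n : ℕ} (hn : 0 < n) (i : ℤ) : (Fin.ofIntMod hn i).val = (i % n).toNat :=
  rfl

theorem Fin.ofIntMod_eq_iff {n : ℕ} (hn : 0 < n) (i j : ℤ) :
    Fin.ofIntMod hn i = Fin.ofIntMod hn j ↔ (n : ℤ) ∣ j - i := by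
  have h1 := Int.emod_nonneg i (show (n : ℤ) ≠ 0 by omega)
  have h2 := Int.emod_nonneg j (show (n : ℤ) ≠ 0 by omega)
  rw [Fin.ofIntMod, Fin.ofIntMod, Fin.mk.injEq, ← Int.emod_eq_emod_iff_emod_sub_eq_zero.trans
    (Int.dvd_iff_emod_eq_zero).symm]
  omega

theorem Fin.ofIntMod_natCast {n : ℕ} (hn : 0 < n) (x : Fin n) : Fin.ofIntMod hn (x.val : ℤ) = x := by
  ext
  have := x.isLt
  simp only [Fin.ofIntMod]
  rw [Int.emod_eq_of_lt (by omega) (by omega)]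
  simp

theorem Fin.ofIntMod_succ_sub {n : ℕ} (hn : 1 < n) (i : ℤ) :
    (Fin.ofIntMod (by omega : 0 < n) (i + 1) - Fin.ofIntMod (by omega) i).val = 1 := by
  have h1 := Int.emod_nonneg i (show (n : ℤ) ≠ 0 by omega)
  have h2 := Int.emod_lt_of_pos i (show (0 : ℤ) < n by omega)
  have h3 : (i + 1) % n = if i % n + 1 < n then i % n + 1 else 0 := by
    rw [← Int.emod_add_emod]
    split_ifs with h
    · exact Int.emod_eq_of_lt (by omega) h
    · rw [show i % n + 1 = (n : ℤ) by omega, Int.emod_self]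
  rw [Fin.val_sub_eq]
  simp only [Fin.val_ofIntMod, h3]
  split_ifs <;> omega

theorem sum_ofIntMod {n : ℕ} (hn : 0 < n) {R : Type*} [AddCommGroup R] (F : Fin n → R) (i : ℤ) :
    ∑ d ∈ range n, F (Fin.ofIntMod hn (i + d)) = ∑ x, F x := by
  rw [sum_range_periodic (f := fun j => F (Fin.ofIntMod hn j)) (fun j => ?_) i 0, Finset.sum_range]
  · refine sum_congr rfl fun x _ => ?_
    rw [zero_add, Fin.ofIntMod_natCast]
  · congr 1
    rw [Fin.ofIntMod_eq_iff]
    exact ⟨-1, by ring⟩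

theorem eq_of_succ_eq {R : Type*} {f : ℤ → R} (hf : ∀ i, f (i + 1) = f i) (i j : ℤ) :
    f i = f j := by
  have h : ∀ k, f k = f 0 := by
    intro k
    induction k using Int.induction_on with
    | zero => rfl
    | succ k ih => rw [hf, ih]
    | pred k ih => rw [← hf, sub_add_cancel, ih]
  rw [h i, h j]

theorem eq_emod_of_periodic {R : Type*} {n : ℕ} {f : ℤ → R} (hf : ∀ i, f (i + n) = f i) (i : ℤ) :
    f i = f (i % n) := by
  have h : f (i % n + i / n * n) = f (i % n) :=
    Function.Periodic.int_mul (f := f) (c := (n : ℤ)) hf (i / n) (i % n)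
  rwa [mul_comm, Int.emod_add_mul_ediv] at h

theorem exists_incr {n : ℕ} {B : Matrix (Fin n) (Fin n) ℂ} (hB : IsBiresidueMatrix B)
    {x y : Fin n} (h : IsSmoothable B x y) (w : Fin n) :
    ∃ z : ℤ, B y w = B x w + B x y * z ∧ (w = x ∨ w = y → z = -1) ∧ (w ≠ x ∧ w ≠ y → 0 ≤ z) := by
  have diag : ∀ u, B u u = 0 := fun u => by
    have := hB.apply_swap u u
    linear_combination (1 / 2 : ℂ) * this
  by_cases hw : w = x ∨ w = y
  · refine ⟨-1, ?_, fun _ => rfl, fun h' => absurd hw (by tauto)⟩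
    rcases hw with rfl | rfl
    · rw [diag, hB.apply_swap w y]; push_cast; ring
    · rw [diag]; push_cast; ring
  · obtain ⟨m, hm⟩ := h.2 w (by tauto) (by tauto)
    refine ⟨m, ?_, fun h' => absurd h' hw, fun _ => by omega⟩
    rw [div_eq_iff h.1, hB.apply_swap x w] at hm
    rw [Int.cast_natCast]
    linear_combination hm

/-- A full smoothable cycle gives real cyclic data. -/
theorem exists_cyclicBiresidue {n : ℕ} (hn : 3 ≤ n) {B : Matrix (Fin n) (Fin n) ℂ}
    (hB : IsBiresidueMatrix B) (hsum : ∀ i, ∑ j, B i j = 0) {σ : Equiv.Perm (Fin n)}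
    (hσ : ∀ i j : Fin n, (j - i).val = 1 → (smoothableGraph B).Adj (σ i) (σ j)) :
    ∃ (s : ℂ) (b : ℤ → ℤ → ℝ) (c : ℤ → ℝ) (M : ℤ → ℤ → ℤ), s ≠ 0 ∧ CyclicBiresidue n b c M ∧
      ∀ i j, B (σ (Fin.ofIntMod (by omega) i)) (σ (Fin.ofIntMod (by omega) j)) = s * b i j := by
  have hn0 : 0 < n := by omega
  let g : ℤ → Fin n := fun i => σ (Fin.ofIntMod hn0 i)
  have g_iff : ∀ i j, g i = g j ↔ (n : ℤ) ∣ j - i := fun i j => by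
    rw [← Fin.ofIntMod_eq_iff hn0]; exact σ.injective.eq_iff
  have g_per : ∀ i, g (i + n) = g i := fun i => (g_iff _ _).2 ⟨-1, by ring⟩
  have hsm : ∀ i, IsSmoothable B (g i) (g (i + 1)) := fun i =>
    ((smoothableGraph_adj hB _ _).1 (hσ _ _ (Fin.ofIntMod_succ_sub (by omega) i))).2
  choose M hM using fun i j => exists_incr hB (hsm i) (g j)
  let C : ℤ → ℂ := fun i => B (g i) (g (i + 1))
  have hC : ∀ i, C i ≠ 0 := fun i => (hsm i).1
  have hCper : ∀ i, C (i + n) = C i := fun i => by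
    change B (g (i + n)) (g (i + n + 1)) = B (g i) (g (i + 1))
    rw [add_right_comm, g_per, g_per]
  have hstep : ∀ i j, B (g (i + 1)) (g j) = B (g i) (g j) + C i * M i j := fun i j => (hM i j).1
  have hM0 : ∀ i j : ℤ, 0 < j - i - 1 → j - i < n → 0 ≤ M i j := by
    intro i j h1 h2
    refine (hM i j).2.2 ⟨fun h => ?_, fun h => ?_⟩
    · have := Int.le_of_dvd (by omega) (dvd_neg.2 ((g_iff _ _).1 h)); omega
    · have := Int.le_of_dvd (by omega) (dvd_neg.2 ((g_iff _ _).1 h)); omega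
  have hadj : ∀ i, C (i + 1) * (1 + M (i + 1) i) = C i * (1 + M i (i + 2)) := by
    intro i
    have k1 := hstep i (i + 2)
    have k2 := hstep (i + 1) i
    have k3 := hB.apply_swap (g i) (g (i + 2))
    have k4 : B (g (i + 1)) (g i) = -C i := hB.apply_swap _ _
    have k5 : B (g (i + 1)) (g (i + 2)) = C (i + 1) := by
      change _ = B (g (i + 1)) (g (i + 1 + 1)); rw [add_assoc]; rfl
    rw [show i + 1 + 1 = i + 2 by ring] at k2
    linear_combination k1 - k2 + k3 - k4 - k5
  -- By `hadj`, consecutive edges have a positive real ratio, so dividing by the single edge `C 0`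
  -- makes all of them real and positive.
  have hpos : ∀ k : ℕ, ∃ r : ℝ, 0 < r ∧ C k = C 0 * r := by
    intro k
    induction k with
    | zero => exact ⟨1, one_pos, by simp⟩
    | succ k ih =>
      obtain ⟨r, hr, hrk⟩ := ih
      have h1 : 0 ≤ M (k + 1) k := by
        have h2 : M (k + 1) (k + n) = M (k + 1) k := by
          have k1 := hstep (k + 1) (k + n)
          have k2 := hstep (k + 1) k
          rw [g_per, k2] at k1
          have := mul_left_cancel₀ (hC _) (add_left_cancel k1)
          exact_mod_cast this.symm
        rw [← h2]; exact hM0 _ _ (by omega) (by omega)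
      have h2 : 0 ≤ M k (k + 2) := hM0 _ _ (by omega) (by omega)
      have h1' : (0 : ℝ) < 1 + M (k + 1) k := by
        have : (0 : ℝ) ≤ M (k + 1) k := by exact_mod_cast h1
        linarith
      have h2' : (0 : ℝ) < 1 + M k (k + 2) := by
        have : (0 : ℝ) ≤ M k (k + 2) := by exact_mod_cast h2
        linarith
      refine ⟨r * (1 + M k (k + 2)) / (1 + M (k + 1) k), by positivity, ?_⟩
      have h3 := hadj k
      have h4 : (1 + M (k + 1) k : ℂ) ≠ 0 := by exact_mod_cast h1'.ne'
      rw [Nat.cast_succ]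
      push_cast
      rw [← mul_div_assoc, eq_div_iff h4, h3, hrk]
      ring
  have hpos' : ∀ i, ∃ r : ℝ, 0 < r ∧ C i = C 0 * r := by
    intro i
    obtain ⟨r, hr, h⟩ := hpos (i % n).toNat
    refine ⟨r, hr, ?_⟩
    rw [← h, Int.toNat_of_nonneg (Int.emod_nonneg i (by omega))]
    exact eq_emod_of_periodic hCper i
  choose c hc0 hc using hpos'
  let b : ℤ → ℤ → ℝ := fun i j => (B (g i) (g j) / C 0).re
  have hbdiv : ∀ i j, B (g (i + 1)) (g j) / C 0 = B (g i) (g j) / C 0 + ((c i * M i j : ℝ) : ℂ) := by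
    intro i j
    rw [hstep, hc]
    field_simp [hC 0]
    push_cast; ring
  have hdiag : ∀ x, B x x = 0 := fun u => by
    have := hB.apply_swap u u
    linear_combination (1 / 2 : ℂ) * this
  -- The increments are real, so the imaginary part of a column does not depend on the row; it
  -- vanishes on the diagonal.
  have hreal : ∀ i j, B (g i) (g j) / C 0 = b i j := by
    intro i j
    have h := eq_of_succ_eq (f := fun i => B (g i) (g j) / C 0 - b i j) (fun i => by
      simp only [b]
      rw [hbdiv, Complex.add_re, Complex.ofReal_re]
      push_cast; ring) i j
    simp only [b, hdiag, zero_div, Complex.zero_re, Complex.ofReal_zero, sub_zero] at h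
    exact sub_eq_zero.1 h
  refine ⟨C 0, b, c, M, hC 0, ?_, fun i j => ?_⟩
  · refine ⟨hn, fun i j => ?_, fun i j => ?_, hc0, fun i j => ?_, fun i => (hM i i).2.1 (Or.inl rfl),
      fun i => (hM i (i + 1)).2.1 (Or.inr rfl), fun i j h1 h2 => hM0 i j (by omega) (by omega),
      fun i => ?_⟩
    · simp only [b]
      rw [hB.apply_swap (g j) (g i), neg_div, Complex.neg_re]
    · simp only [b]; rw [g_per]
    · simp only [b]
      rw [hbdiv, Complex.add_re, Complex.ofReal_re]
    · simp only [b]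
      rw [← Complex.re_sum, ← sum_div]
      have h1 := sum_ofIntMod hn0 (fun x => B (g i) (σ x)) i
      rw [Equiv.sum_comp σ (fun x => B (g i) x), hsum] at h1
      change (((∑ d ∈ range n, B (g i) (σ (Fin.ofIntMod hn0 (i + d)))) / C 0).re) = 0
      rw [h1, zero_div, Complex.zero_re]
  · have := hreal i j
    rw [← this, mul_div_cancel₀ _ (hC 0)]

theorem kernelConstant_of_rank {n : ℕ} (hn : 0 < n) {B : Matrix (Fin n) (Fin n) ℂ}
    (hsum : ∀ i, ∑ j, B i j = 0) (hrank : B.rank + 1 = n) {σ : Equiv.Perm (Fin n)} {s : ℂ}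
    {b : ℤ → ℤ → ℝ}
    (hb : ∀ i j, B (σ (Fin.ofIntMod hn i)) (σ (Fin.ofIntMod hn j)) = s * b i j) :
    KernelConstant n b := by
  intro v hv hrow
  let w : Fin n → ℂ := fun x => v ((σ.symm x).val : ℤ)
  have hwv : ∀ j, w (σ (Fin.ofIntMod hn j)) = v j := by
    intro j
    simp only [w, Equiv.symm_apply_apply, Fin.ofIntMod]
    rw [Int.toNat_of_nonneg (Int.emod_nonneg j (by omega))]
    rw [← eq_emod_of_periodic hv j]
  have hw : B.mulVec w = 0 := by
    ext x
    obtain ⟨i, rfl⟩ : ∃ i : ℤ, σ (Fin.ofIntMod hn i) = x :=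
      ⟨(σ.symm x).val, by rw [Fin.ofIntMod_natCast, Equiv.apply_symm_apply]⟩
    have h1 := sum_ofIntMod hn (fun y => B (σ (Fin.ofIntMod hn i)) (σ y) * w (σ y)) i
    rw [Equiv.sum_comp σ (fun y => B (σ (Fin.ofIntMod hn i)) y * w y)] at h1
    rw [Matrix.mulVec, dotProduct, ← h1, Pi.zero_apply]
    have h2 : ((∑ d ∈ range n, b i (i + d) * v (i + d) : ℝ) : ℂ) = 0 := by
      rw [hrow, Complex.ofReal_zero]
    push_cast at h2
    rw [← mul_zero s, ← h2, mul_sum]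
    refine sum_congr rfl fun d _ => ?_
    rw [hb, hwv, mul_assoc]
  intro i j
  have h := mulVec_eq_zero_const hsum hrank hw (σ (Fin.ofIntMod hn i)) (σ (Fin.ofIntMod hn j))
  rw [hwv, hwv] at h
  exact_mod_cast h

theorem mainTheorem3 (n : ℕ) (B : Matrix (Fin n) (Fin n) ℂ)
    (hB : IsBiresidueMatrix B)
    (hsum : ∀ i : Fin n, ∑ j : Fin n, B i j = 0)
    (hrank : B.rank + 1 = n) :
    HasFullSmoothableCycle B ↔
      ∃ k : ℕ, 1 ≤ k ∧ 2 * k < n ∧ Nat.gcd n k = 1 ∧ Nat.gcd n (k + 1) = 1 ∧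
        ProjectivelyEquivalent B (cyclicMatrix n k) := by
  constructor
  · intro h
    have hn : 3 ≤ n := by
      obtain ⟨v, p, hp⟩ := h
      have h1 := hp.isCycle.three_le_length
      rwa [hp.length_eq, Fintype.card_fin] at h1
    obtain ⟨σ, hσ⟩ := (smoothableCycle_iff hn B).1 h
    obtain ⟨s, b, c, M, hs, D, hb⟩ := exists_cyclicBiresidue hn hB hsum hσ
    obtain ⟨r, hr, k, hk, hkn, hg, hg', pos, zero, neg⟩ :=
      D.circulant (odd_of_rank hB hsum hrank) (kernelConstant_of_rank (by omega) hsum hrank hb)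
    refine ⟨k, hk, hkn, hg, hg', (projectivelyEquivalent_iff _ _).2
      ⟨σ, r / s, div_ne_zero (by exact_mod_cast hr.ne') hs, fun i j => ?_⟩⟩
    have hi := i.isLt
    have hj := j.isLt
    have h1 := hb i.val j.val
    rw [Fin.ofIntMod_natCast, Fin.ofIntMod_natCast] at h1
    rw [h1, ← mul_assoc, div_mul_cancel₀ _ hs, ← Complex.ofReal_mul]
    simp only [cyclicMatrix, Matrix.of_apply, cyclicRow]
    have hd := Fin.val_sub_eq i j
    generalize (j - i).val = d at hd
    rcases lt_trichotomy i.val j.val with hij | hij | hij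
    · rw [if_pos hij.le] at hd
      split_ifs with h2 h3
      · rw [pos i.val j.val (by omega) (by omega), Complex.ofReal_one]
      · rw [neg i.val j.val (by omega) (by omega), Complex.ofReal_neg, Complex.ofReal_one]
      · rw [zero i.val j.val (by omega) (by omega), Complex.ofReal_zero]
    · rw [if_pos hij.le] at hd
      rw [hij, D.diag, mul_zero, Complex.ofReal_zero, if_neg (by omega), if_neg (by omega)]
    · rw [if_neg (by omega)] at hd
      rw [← D.periodic_right]
      split_ifs with h2 h3
      · rw [pos i.val (j.val + n) (by omega) (by omega), Complex.ofReal_one]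
      · rw [neg i.val (j.val + n) (by omega) (by omega), Complex.ofReal_neg, Complex.ofReal_one]
      · rw [zero i.val (j.val + n) (by omega) (by omega), Complex.ofReal_zero]
  · rintro ⟨k, hk, hkn, -, -, h⟩
    exact hasFullSmoothableCycle_of_cyclicMatrix hB hk hkn h
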